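/- **Setting.** Let $\mathbb F=\mathbb R$ or $\mathbb F=\mathbb C$. For $v_1,\dots,v_d\in\mathbb F^m$ put $$v_1\wedge\dots\wedge v_d=\sum_{\sigma\in\mathfrak S_d}\operatorname{sign}(\sigma)\,v_{\sigma(1)}\otimes\dots\otimes v_{\sigma(d)}\in(\mathbb F^m)^{\otimes d};$$ these are the elementary skew-symmetric tensors, and $\wedge^d\mathbb F^m$ is their linear span. A *Grassmann decomposition* of $T$ of length $s$ is an expression $T=T_1+\dots+T_s$ with all $T_i$ nonzero elementary skew-symmetric tensors over $\mathbb F$; the *Grassmann rank* of $T$ is the smallest such $s$. A property holds for a *generic* element of a set $X$ in a finite-dimensional $\mathbb F$-vector space if there is a polynomial function $p$ over $\mathbb F$, not vanishing identically on $X$, such that the property holds for every $x\in X$ with $p(x)\neq0$. Write $(B_1,\dots,B_d)\cdot T$ for multilinear multiplication and $X\cdot_kT$ for multiplication by the matrix $X$ in the $k$-th factor only. $T_{(1)}$ is the first flattening of $T$, the matrix whose rows are indexed by the first tensor index. **Algorithm** (input $T\in\wedge^d\mathbb F^m$ and $r$ with $dr\le m$; $n:=dr$). * S0. Compute $U\in\mathbb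 F^{m\times n}$ whose columns are an orthonormal basis of the column span of $T_{(1)}$, and set $A=(U^H,\dots,U^H)\cdot T$. * S1, S2. Compute the kernel $\kappa_A\subseteq\mathbb F^{n\times n}$ of the linear map $\delta_A(X)=\sum_{k=1}^dX\cdot_kA$. * S3. Choose a generic $K\in\kappa_A$ and compute an eigendecomposition $K=W\Lambda W^{-1}$, with $\Lambda$ diagonal and $W$, $\Lambda$ complex. * S4. Choose a generic $K'\in\kappa_A$ and compute a permutation matrix $P$ such that $P^TW^{-1}K'WP$ is block diagonal with $r$ blocks of size $d\times d$. * S5. Partition $WP=[V_1\ \cdots\ V_r]$ into $n\times d$ blocks, and possibly replace each $V_i$ by another $n\times d$ complex matrix with the same column span; write $V_i=[v_i^1\ \cdots\ v_i^d]$. * S6. Solve the linear system $\sum_{i=1}^rx_i\,v_i^1\wedge\dots\wedge v_i^d=A$ for $x_1,\dots,x_r\in\mathbb C$. * S7. Return $D=[D_1\ \cdots\ D_r]$, where $D_i$ is $UV_i$ with its first column multiplied by $x_i$. The block $D_i=[d_i^1\ \cdots\ d_i^d]$ represents the elementary tensor $d_i^1\wedge\dots\wedge d_i^d=x_i\,(Uv_i^1)\wedge\dots\wedge(Uv_i^d)$.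 **Theorem.** Let $d\ge3$, $r\geq 0$ and $m\ge dr$. For a generic element $T$ of the set of tensors of Grassmann rank $r$ in $\wedge^d\mathbb F^m$ the algorithm is correct. That is, there is a matrix $U$ as in S0, and for every such $U$, for generic $K\in\kappa_A$, there is an eigendecomposition as in S3, and for every such eigendecomposition, for generic $K'\in\kappa_A$ (the genericity condition may depend on the earlier choices), there is a permutation matrix $P$ as in S4, and for every such $P$ and every choice in S5, the linear system in S6 has a unique solution, and the elementary tensors $T_i:=d_i^1\wedge\dots\wedge d_i^d$, $i=1,\dots,r$, represented by the returned matrix $D$ are nonzero elementary skew-symmetric tensors over $\mathbb F$ (that is, each $T_i$ is also the wedge product of $d$ vectors of $\mathbb F^m$) with $$T=T_1+\dots+T_r .$$ -/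

import Mathlib

open scoped Matrix

noncomputable section

namespace GrassmannAlg

/-- Order-`d` tensors in `(𝕜^ι)^{⊗d}`, written in coordinates with respect to the standard basis:
the value at `j` is the coefficient of `e_{j 0} ⊗ ⋯ ⊗ e_{j (d-1)}`. -/
abbrev Tensor (d : ℕ) (ι : Type*) (𝕜 : Type*) : Type _ := (Fin d → ι) → 𝕜

/-- The wedge product `v_1 ∧ ⋯ ∧ v_d = ∑_σ sign(σ) v_{σ 1} ⊗ ⋯ ⊗ v_{σ d}`. -/
def wedge {𝕜 : Type*} [Field 𝕜] {d : ℕ} {ι : Type*} (v : Fin d → ι → 𝕜) : Tensor d ι 𝕜 :=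
  fun j => ∑ σ : Equiv.Perm (Fin d), ((Equiv.Perm.sign σ : ℤ) : 𝕜) * ∏ k, v (σ k) (j k)

/-- Nonzero elementary skew-symmetric tensors. -/
def IsElementary {𝕜 : Type*} [Field 𝕜] {d : ℕ} {ι : Type*} (A : Tensor d ι 𝕜) : Prop :=
  A ≠ 0 ∧ ∃ v : Fin d → ι → 𝕜, A = wedge v

/-- `S` is a Grassmann decomposition of `T` with `s` summands. -/
def IsGrassmannDecomposition {𝕜 : Type*} [Field 𝕜] {d : ℕ} {ι : Type*} {s : ℕ}
    (T : Tensor d ι 𝕜) (S : Fin s → Tensor d ι 𝕜) : Prop :=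
  (∀ i, IsElementary (S i)) ∧ ∑ i, S i = T

/-- `T` has Grassmann rank `r`: it is a sum of `r`, and of no fewer than `r`, nonzero elementary
skew-symmetric tensors over `𝕜`. In particular `T` is then skew-symmetric, as it lies in the span
of the elementary skew-symmetric tensors. -/
def HasGrassmannRank {𝕜 : Type*} [Field 𝕜] {d : ℕ} {ι : Type*} (T : Tensor d ι 𝕜) (r : ℕ) :
    Prop :=
  IsLeast {s : ℕ | ∃ S : Fin s → Tensor d ι 𝕜, IsGrassmannDecomposition T S} r

/-- `P` holds for a generic element of the set `X`: among the elements of `X`, the property can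
fail only on the zero locus of a polynomial function that does not vanish identically on `X`.
Polynomial functions on `E` are polynomials in linear forms. -/
def Generic (𝕜 : Type*) [Field 𝕜] {E : Type*} [AddCommGroup E] [Module 𝕜 E]
    (X : Set E) (P : E → Prop) : Prop :=
  ∃ p : MvPolynomial (Module.Dual 𝕜 E) 𝕜,
    (∃ x ∈ X, MvPolynomial.eval (fun φ : Module.Dual 𝕜 E => φ x) p ≠ 0) ∧
    ∀ x ∈ X, MvPolynomial.eval (fun φ : Module.Dual 𝕜 E => φ x) p ≠ 0 → P x

/-- Multilinear multiplication `(B_1, …, B_d) · T`. -/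
def multilinearMul {𝕜 : Type*} [Field 𝕜] {d : ℕ} {ι κ : Type*} [Fintype ι]
    (B : Fin d → Matrix κ ι 𝕜) (T : Tensor d ι 𝕜) : Tensor d κ 𝕜 :=
  fun i => ∑ j : Fin d → ι, (∏ k, B k (i k) (j k)) * T j

/-- `X ·_k T = (Id, …, Id, X, Id, …, Id) · T`, with `X` in position `k`. -/
def modeMul {𝕜 : Type*} [Field 𝕜] {d : ℕ} {ι : Type*} [Fintype ι] [DecidableEq ι]
    (k : Fin d) (X : Matrix ι ι 𝕜) (T : Tensor d ι 𝕜) : Tensor d ι 𝕜 :=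
  multilinearMul (Function.update (fun _ => (1 : Matrix ι ι 𝕜)) k X) T

/-- The standard `k`-th flattening `T_(k)`. -/
def flattening {𝕜 : Type*} {d : ℕ} {ι : Type*} (k : Fin d) (T : Tensor d ι 𝕜) :
    Matrix ι ({l : Fin d // l ≠ k} → ι) 𝕜 :=
  Matrix.of fun a j => T fun l => if h : l = k then a else j ⟨l, h⟩

theorem modeMul_prod {𝕜 : Type*} [Field 𝕜] {d : ℕ} {ι : Type*} [DecidableEq ι]
    (k : Fin d) (X : Matrix ι ι 𝕜) (i j : Fin d → ι) :
    (∏ l, Function.update (fun _ => (1 : Matrix ι ι 𝕜)) k X l (i l) (j l)) =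
      X (i k) (j k) * ∏ l ∈ Finset.univ.erase k, (1 : Matrix ι ι 𝕜) (i l) (j l) := by
  rw [← Finset.mul_prod_erase Finset.univ _ (Finset.mem_univ k), Function.update_self]
  congr 1
  refine Finset.prod_congr rfl fun l hl => ?_
  rw [Function.update_of_ne (Finset.ne_of_mem_erase hl)]

/-- The linear map `δ_A : X ↦ ∑_k X ·_k A` on matrices. For skew-symmetric `A` its values are
skew-symmetric; they are regarded here as elements of the full tensor space, which does not
affect the kernel. -/
def delta {𝕜 : Type*} [Field 𝕜] {d : ℕ} {ι : Type*} [Fintype ι] [DecidableEq ι]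
    (A : Tensor d ι 𝕜) : Matrix ι ι 𝕜 →ₗ[𝕜] Tensor d ι 𝕜 where
  toFun X := ∑ k, modeMul k X A
  map_add' X Y := by
    rw [← Finset.sum_add_distrib]
    refine Finset.sum_congr rfl fun k _ => ?_
    funext i
    simp only [modeMul, multilinearMul, modeMul_prod, Pi.add_apply, Matrix.add_apply, add_mul,
      Finset.sum_add_distrib]
  map_smul' c X := by
    rw [RingHom.id_apply, Finset.smul_sum]
    refine Finset.sum_congr rfl fun k _ => ?_
    funext i
    simp only [modeMul, multilinearMul, modeMul_prod, Pi.smul_apply, Matrix.smul_apply,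
      smul_eq_mul, mul_assoc, Finset.mul_sum]

/-- The kernel `κ_A` of `δ_A`. -/
def kappa {𝕜 : Type*} [Field 𝕜] {d : ℕ} {ι : Type*} [Fintype ι] [DecidableEq ι]
    (A : Tensor d ι 𝕜) : Submodule 𝕜 (Matrix ι ι 𝕜) :=
  LinearMap.ker (delta A)

/-- The `n = d * r` coordinates of the compressed space `𝕜^{dr}`. The index `(k, i)` stands for
position `k` in block `i`, so an `n × n` matrix is partitioned as `[V_1 … V_r]`, where the columns
of `V_i` are those with indices `(0, i), …, (d-1, i)`. -/
abbrev BlockIdx (d r : ℕ) : Type := Fin d × Fin r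

/-- The columns `v_i^1, …, v_i^d` of the `i`-th block `V_i` of `V = [V_1 … V_r]`. -/
def blockCols {R : Type*} {d r : ℕ} {ι : Type*} (V : Matrix ι (BlockIdx d r) R) (i : Fin r) :
    Fin d → ι → R :=
  fun k => V.col (k, i)

/-- The inclusion of matrices over `𝕜` (the reals or the complex numbers) into the complex ones. -/
def matrixToComplex {𝕜 : Type*} [RCLike 𝕜] {ι κ : Type*} (M : Matrix ι κ 𝕜) : Matrix ι κ ℂ :=
  M.map (RCLike.map 𝕜 ℂ)

/-- The inclusion of tensors over `𝕜` (the reals or the complex numbers) into the complex ones. -/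
def tensorToComplex {𝕜 : Type*} [RCLike 𝕜] {d : ℕ} {ι : Type*} (T : Tensor d ι 𝕜) :
    Tensor d ι ℂ :=
  fun j => RCLike.map 𝕜 ℂ (T j)

/-! The steps of the algorithm -/

/-- First step: the columns of `U` are an orthonormal basis of the column span of `T_(k)`. -/
def IsCompressionBasis {𝕜 : Type*} [RCLike 𝕜] {d m : ℕ} {ν : Type*} [Fintype ν] [DecidableEq ν]
    (k : Fin d) (T : Tensor d (Fin m) 𝕜) (U : Matrix (Fin m) ν 𝕜) : Prop :=
  Uᴴ * U = 1 ∧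
    Submodule.span 𝕜 (Set.range U.col) = Submodule.span 𝕜 (Set.range (flattening k T).col)

/-- First step: the compressed tensor `A = (Uᴴ, …, Uᴴ) · T`. -/
def compress {𝕜 : Type*} [RCLike 𝕜] {d m : ℕ} {ν : Type*}
    (U : Matrix (Fin m) ν 𝕜) (T : Tensor d (Fin m) 𝕜) : Tensor d ν 𝕜 :=
  multilinearMul (fun _ => Uᴴ) T

/-- `K = W Λ W⁻¹` is an eigendecomposition over the complex numbers. -/
def IsEVD {ν : Type*} [Fintype ν] [DecidableEq ν] (K W : Matrix ν ν ℂ) (Λ : ν → ℂ) : Prop :=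
  IsUnit W.det ∧ K = W * Matrix.diagonal Λ * W⁻¹

/-- `P` is a permutation matrix for which `Pᵀ C P` is block diagonal, with `r` diagonal blocks of
size `d × d`. -/
def IsBlockDiagonalizer {d r : ℕ} (C P : Matrix (BlockIdx d r) (BlockIdx d r) ℂ) : Prop :=
  (∃ π : Equiv.Perm (BlockIdx d r), P = π.permMatrix ℂ) ∧
    ∃ B : Fin r → Matrix (Fin d) (Fin d) ℂ, Pᵀ * C * P = Matrix.blockDiagonal B

/-- `V'` results from improving the blocks of `V`: each `V_i` is replaced by a matrix with `d`
columns and the same column span (possibly `V_i` itself). -/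
def IsRefinement {d r : ℕ} (V V' : Matrix (BlockIdx d r) (BlockIdx d r) ℂ) : Prop :=
  ∀ i, Submodule.span ℂ (Set.range (blockCols V' i)) =
    Submodule.span ℂ (Set.range (blockCols V i))

/-- `x` solves the linear system `∑_i x_i v_i^1 ∧ ⋯ ∧ v_i^d = A`. -/
def SolvesScalars {d r : ℕ} (V : Matrix (BlockIdx d r) (BlockIdx d r) ℂ)
    (A : Tensor d (BlockIdx d r) ℂ) (x : Fin r → ℂ) : Prop :=
  ∑ i, x i • wedge (blockCols V i) = A

/-- The factor matrix returned by the algorithm: `[U V_1 … U V_r]`, in which the first column of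
the `i`-th block is multiplied by `x_i`, so that this block represents the elementary tensor
`x_i (U v_i^1) ∧ ⋯ ∧ (U v_i^d)`. -/
def outputMatrix {𝕜 : Type*} [RCLike 𝕜] {d r m : ℕ} (U : Matrix (Fin m) (BlockIdx d r) 𝕜)
    (V : Matrix (BlockIdx d r) (BlockIdx d r) ℂ) (x : Fin r → ℂ) :
    Matrix (Fin m) (BlockIdx d r) ℂ :=
  Matrix.of fun a c => (if c.1.val = 0 then x c.2 else 1) * (matrixToComplex U * V) a c

/-- The elementary tensors represented by the blocks of the factor matrix `D` are (the complex
versions of) elementary skew-symmetric tensors over `𝕜` that decompose `T`. -/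
def RepresentsDecomposition {𝕜 : Type*} [RCLike 𝕜] {d r m : ℕ} (T : Tensor d (Fin m) 𝕜)
    (D : Matrix (Fin m) (BlockIdx d r) ℂ) : Prop :=
  ∃ S : Fin r → Tensor d (Fin m) 𝕜, IsGrassmannDecomposition T S ∧
    ∀ i, wedge (blockCols D i) = tensorToComplex (S i)

/-- The algorithm is correct on the input `T`: every step can be carried out, and for every
outcome of the steps (all choices of an orthonormal basis `U`, all generic choices of `K`, all
eigendecompositions, all choices of `K'` that are generic given the previous choices, all
block-diagonalizing permutations, all improvements of the blocks, all solutions of the linear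
system) the returned factor matrix represents a Grassmann decomposition of `T`. -/
def AlgorithmCorrectOn {𝕜 : Type*} [RCLike 𝕜] {d : ℕ} (r : ℕ) {m : ℕ} (k₀ : Fin d)
    (T : Tensor d (Fin m) 𝕜) : Prop :=
  (∃ U : Matrix (Fin m) (BlockIdx d r) 𝕜, IsCompressionBasis k₀ T U) ∧
  ∀ U : Matrix (Fin m) (BlockIdx d r) 𝕜, IsCompressionBasis k₀ T U →
    Generic 𝕜 (kappa (compress U T) : Set (Matrix (BlockIdx d r) (BlockIdx d r) 𝕜)) fun K =>
      (∃ W Λ, IsEVD (matrixToComplex K) W Λ) ∧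
      ∀ W Λ, IsEVD (matrixToComplex K) W Λ →
        Generic 𝕜 (kappa (compress U T) : Set (Matrix (BlockIdx d r) (BlockIdx d r) 𝕜)) fun K' =>
          (∃ P, IsBlockDiagonalizer (W⁻¹ * matrixToComplex K' * W) P) ∧
          ∀ P, IsBlockDiagonalizer (W⁻¹ * matrixToComplex K' * W) P →
            ∀ V, IsRefinement (W * P) V →
              (∃! x : Fin r → ℂ, SolvesScalars V (tensorToComplex (compress U T)) x) ∧
              ∀ x : Fin r → ℂ, SolvesScalars V (tensorToComplex (compress U T)) x →
                RepresentsDecomposition T (outputMatrix U V x)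

end GrassmannAlg

end

/-! A suitable `dr × dr` minor of a flattening (`pivotMatrix`) is nonzero at the sum of `r` wedge
products of disjoint sets of unit vectors. Where it does not vanish, the vectors of every
decomposition of length `r` are linearly independent, so compression loses nothing and `A` is the
sum of the wedge products of the blocks of an invertible matrix `M`.

In the basis given by `M`, the kernel `κ_A` consists of block diagonal matrices: the Lie algebra
action has no other stabilizers once `d ≥ 3` (`kappa_blockTensor_offDiag`). It contains all block
diagonal matrices with traceless blocks, since a derivation scales a wedge product by a trace
(`mem_kappa_blockTensor`). Hence a generic `K` has simple spectrum, and each eigenvector lies in the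
span of one block, its label (`exists_labels`). A generic `K'`, written in the eigenbasis, vanishes
between different labels and has no zero off-diagonal entry within a label (`exists_labels_kappa`).
So every permutation that makes it block diagonal sorts the eigenvectors by label
(`exists_perm_of_blockDiagonal`), and the resulting subspaces are the original ones.

A subspace determines its wedge product up to a factor, and the linear system recovers these factors
uniquely. The output is then the original list of summands in another order, so it is defined over
the base field even if `W` is not. Genericity also has to be witnessed over the base field;
`exists_descent` achieves this. -/

noncomputable section

namespace GrassmannAlg

/-! ### Wedge products, multilinear multiplication and the derivation action. -/

section TensorAlgebra

variable {k : Type*} [Field k] {d : ℕ} {ι κ μ : Type*}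

theorem wedge_apply (v : Fin d → ι → k) (j : Fin d → ι) :
    wedge v j = (Matrix.of fun a b => v a (j b)).det := by
  rw [Matrix.det_apply']
  rfl

theorem wedge_comp_perm (v : Fin d → ι → k) (j : Fin d → ι) (σ : Equiv.Perm (Fin d)) :
    wedge v (j ∘ σ) = ((Equiv.Perm.sign σ : ℤ) : k) * wedge v j := by
  rw [wedge_apply, wedge_apply, ← Matrix.det_permute']
  rfl

/-- Replacing the vectors by linear combinations multiplies the wedge product by a determinant. -/
theorem wedge_mul (V : Matrix ι (Fin d) k) (G : Matrix (Fin d) (Fin d) k) :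
    wedge (V * G).col = G.det • wedge V.col := by
  funext j
  rw [Pi.smul_apply, wedge_apply, wedge_apply, smul_eq_mul, ← Matrix.det_transpose G,
    ← Matrix.det_mul]
  congr 1
  ext a b
  simp [Matrix.mul_apply, Matrix.col, mul_comm]

/-- Terms with a repeated vector drop out. Summed over `l`, these diagonal coefficients make a
derivation act on a wedge product by a trace. -/
theorem wedge_update_sum (v : Fin d → ι → k) (l : Fin d) (c : Fin d → k) :
    wedge (Function.update v l (∑ a, c a • v a)) = c l • wedge v := by
  funext j
  rw [Pi.smul_apply, wedge_apply, wedge_apply, ← Matrix.det_updateRow_sum]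
  congr 1
  ext a b
  by_cases h : a = l
  · subst h; simp [Finset.sum_apply]
  · simp [h]

theorem wedge_update_smul (v : Fin d → ι → k) (l : Fin d) (c : k) :
    wedge (Function.update v l (c • v l)) = c • wedge v := by
  have h := wedge_update_sum v l (Pi.single l c)
  rw [Finset.sum_eq_single l (fun b _ hb => by rw [Pi.single_eq_of_ne hb, zero_smul]) (by simp),
    Pi.single_eq_same] at h
  exact h

/-- Laplace expansion of a wedge product along one tensor position. -/
theorem wedge_update_index [DecidableEq ι] (v : Fin d → ι → k) (j : Fin d → ι) (l : Fin d)
    (a : ι) :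
    wedge v (Function.update j l a) =
      ∑ b, v b a * (Matrix.of fun a b => v a (j b)).adjugate l b := by
  have h : wedge v (Function.update j l a) =
      Matrix.cramer (Matrix.of fun a b => v a (j b)) (fun b => v b a) l := by
    rw [wedge_apply, Matrix.cramer_apply]
    congr 1
    ext x y
    by_cases h : y = l
    · subst h; simp
    · simp [h]
  rw [h, Matrix.cramer_eq_adjugate_mulVec]
  simp [Matrix.mulVec, dotProduct, mul_comm]

variable [Fintype ι]

theorem multilinearMul_comp [Fintype κ] (B : Fin d → Matrix μ κ k) (C : Fin d → Matrix κ ι k)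
    (T : Tensor d ι k) :
    multilinearMul B (multilinearMul C T) = multilinearMul (fun l => B l * C l) T := by
  classical
  funext i
  simp only [multilinearMul, Matrix.mul_apply, Finset.mul_sum]
  rw [Finset.sum_comm]
  refine Finset.sum_congr rfl fun j _ => ?_
  rw [Finset.prod_univ_sum, Finset.sum_mul, Fintype.piFinset_univ]
  refine Finset.sum_congr rfl fun x _ => ?_
  rw [Finset.prod_mul_distrib]
  ring

theorem multilinearMul_sum {α : Type*} (s : Finset α) (B : Fin d → Matrix κ ι k)
    (T : α → Tensor d ι k) :
    multilinearMul B (∑ i ∈ s, T i) = ∑ i ∈ s, multilinearMul B (T i) := by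
  funext i
  simp only [multilinearMul, Finset.sum_apply, Finset.mul_sum]
  rw [Finset.sum_comm]

theorem multilinearMul_smul (B : Fin d → Matrix κ ι k) (c : k) (T : Tensor d ι k) :
    multilinearMul B (c • T) = c • multilinearMul B T := by
  funext i
  simp only [multilinearMul, Pi.smul_apply, smul_eq_mul, Finset.mul_sum]
  exact Finset.sum_congr rfl fun _ _ => by ring

theorem multilinearMul_zero (B : Fin d → Matrix κ ι k) :
    multilinearMul B (0 : Tensor d ι k) = 0 := by
  funext i
  simp [multilinearMul]

/-- Multilinear multiplication of a wedge product, possibly by different matrices. -/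
theorem multilinearMul_wedge_apply (B : Fin d → Matrix κ ι k) (v : Fin d → ι → k)
    (i : Fin d → κ) :
    multilinearMul B (wedge v) i = ∑ σ : Equiv.Perm (Fin d),
      ((Equiv.Perm.sign σ : ℤ) : k) * ∏ l, (B l *ᵥ v (σ l)) (i l) := by
  classical
  simp only [multilinearMul, wedge, Finset.mul_sum, Matrix.mulVec, dotProduct]
  rw [Finset.sum_comm]
  refine Finset.sum_congr rfl fun σ _ => ?_
  rw [Finset.prod_univ_sum, Finset.mul_sum, Fintype.piFinset_univ]
  refine Finset.sum_congr rfl fun x _ => ?_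
  rw [Finset.prod_mul_distrib]
  ring

theorem multilinearMul_wedge (B : Matrix κ ι k) (v : Fin d → ι → k) :
    multilinearMul (fun _ => B) (wedge v) = wedge fun l => B *ᵥ v l := by
  funext i
  rw [multilinearMul_wedge_apply]
  rfl

theorem modeMul_apply [DecidableEq ι] (l : Fin d) (X : Matrix ι ι k) (T : Tensor d ι k)
    (j : Fin d → ι) :
    modeMul l X T j = ∑ a, X (j l) a * T (Function.update j l a) := by
  classical
  simp only [modeMul, multilinearMul, modeMul_prod]
  symm
  refine Finset.sum_of_injOn (fun a => Function.update j l a)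
    (fun a _ b _ h => by simpa using congrFun h l) (fun _ _ => Finset.mem_univ _) ?_ ?_
  -- An index that differs from `j` at some position other than `l` meets a zero entry of an
  -- identity factor.
  · intro x _ hx
    obtain ⟨y, hy, hne⟩ : ∃ y, y ≠ l ∧ j y ≠ x y := by
      by_contra! h
      refine hx ⟨x l, by simp, ?_⟩
      funext y
      by_cases hy : y = l
      · subst hy; simp
      · simp [hy, h y hy]
    rw [show ∏ y ∈ Finset.univ.erase l, (1 : Matrix ι ι k) (j y) (x y) = 0 from
      Finset.prod_eq_zero (Finset.mem_erase.2 ⟨hy, Finset.mem_univ y⟩) (Matrix.one_apply_ne hne),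
      mul_zero, zero_mul]
  · intro a _
    rw [Finset.prod_eq_one]
    · simp
    · intro y hy
      rw [Function.update_of_ne (Finset.ne_of_mem_erase hy), Matrix.one_apply_eq]

theorem modeMul_multilinearMul [DecidableEq ι] (l : Fin d) (M N X : Matrix ι ι k)
    (T : Tensor d ι k) (h : M * N = 1) :
    multilinearMul (fun _ => M) (modeMul l X T) =
      modeMul l (M * X * N) (multilinearMul (fun _ => M) T) := by
  have h' : N * M = 1 := mul_eq_one_comm.1 h
  simp only [modeMul, multilinearMul_comp]
  congr 1
  funext y
  by_cases hy : y = l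
  · subst hy; simp [Matrix.mul_assoc, h']
  · simp [hy]

/-- Equivariance of `δ` under change of basis; it reduces kernel computations to the standard
tensor. -/
theorem delta_multilinearMul [DecidableEq ι] (M N X : Matrix ι ι k) (T : Tensor d ι k)
    (h : M * N = 1) :
    multilinearMul (fun _ => M) (delta T X) =
      delta (multilinearMul (fun _ => M) T) (M * X * N) := by
  simp only [delta, LinearMap.coe_mk, AddHom.coe_mk, multilinearMul_sum]
  exact Finset.sum_congr rfl fun l _ => modeMul_multilinearMul l M N X T h

/-- The maps `δ` act as derivations on wedge products. -/
theorem delta_wedge [DecidableEq ι] (v : Fin d → ι → k) (X : Matrix ι ι k) :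
    delta (wedge v) X = ∑ l, wedge (Function.update v l (X *ᵥ v l)) := by
  funext i
  simp only [delta, LinearMap.coe_mk, AddHom.coe_mk, modeMul, Finset.sum_apply,
    multilinearMul_wedge_apply, wedge]
  rw [Finset.sum_comm, Finset.sum_comm (s := Finset.univ (α := Fin d))]
  refine Finset.sum_congr rfl fun σ _ => ?_
  -- For fixed `σ`, position `l` carries the vector `σ l`, so the sum over positions becomes a sum
  -- over vectors.
  refine Eq.trans (Finset.sum_congr rfl fun l _ => ?_) (Equiv.sum_comp σ _)
  congr 1
  refine Finset.prod_congr rfl fun y _ => ?_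
  by_cases hy : y = l
  · subst hy; simp
  · simp [hy]

theorem delta_sum [DecidableEq ι] {α : Type*} (s : Finset α) (T : α → Tensor d ι k)
    (X : Matrix ι ι k) : delta (∑ i ∈ s, T i) X = ∑ i ∈ s, delta (T i) X := by
  simp only [delta, LinearMap.coe_mk, AddHom.coe_mk, modeMul, multilinearMul_sum]
  rw [Finset.sum_comm]

end TensorAlgebra

/-! ### Sums of wedge products of blocks, and the kernel of `δ`. -/

section BlockTensor

variable {k : Type*} [Field k] {d r : ℕ} {ι κ : Type*}

/-- The sum of the wedge products of the blocks of `V`. -/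
def blockTensor (V : Matrix ι (BlockIdx d r) k) : Tensor d ι k :=
  ∑ i, wedge (blockCols V i)

theorem multilinearMul_blockCols [Fintype ι] (B : Matrix κ ι k) (V : Matrix ι (BlockIdx d r) k)
    (i : Fin r) :
    multilinearMul (fun _ => B) (wedge (blockCols V i)) = wedge (blockCols (B * V) i) :=
  multilinearMul_wedge B _

theorem multilinearMul_blockTensor [Fintype ι] (B : Matrix κ ι k)
    (V : Matrix ι (BlockIdx d r) k) :
    multilinearMul (fun _ => B) (blockTensor V) = blockTensor (B * V) := by
  simp only [blockTensor, multilinearMul_sum, multilinearMul_blockCols]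

theorem wedge_blockCols_one_eq_zero_of_index {i : Fin r} {j : Fin d → BlockIdx d r} (l : Fin d)
    (h : (j l).2 ≠ i) : wedge (blockCols (1 : Matrix _ (BlockIdx d r) k) i) j = 0 := by
  rw [wedge_apply]
  refine Matrix.det_eq_zero_of_column_eq_zero l fun a => ?_
  simp only [Matrix.of_apply, blockCols, Matrix.col_apply]
  exact Matrix.one_apply_ne fun h' => h (by rw [h'])

theorem blockTensor_one_eq_zero {j : Fin d → BlockIdx d r} {x y : Fin d}
    (h : (j x).2 ≠ (j y).2) : blockTensor (1 : Matrix _ (BlockIdx d r) k) j = 0 := by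
  rw [blockTensor, Finset.sum_apply]
  refine Finset.sum_eq_zero fun i _ => ?_
  by_cases hx : (j x).2 = i
  · exact wedge_blockCols_one_eq_zero_of_index y fun hy => h (hx.trans hy.symm)
  · exact wedge_blockCols_one_eq_zero_of_index x hx

theorem wedge_blockCols_one_diag (i : Fin r) :
    wedge (blockCols (1 : Matrix _ (BlockIdx d r) k) i) (fun l => (l, i)) = 1 := by
  rw [wedge_apply]
  convert! Matrix.det_one (n := Fin d) (R := k)
  ext a b
  simp [blockCols, Matrix.one_apply, eq_comm]

theorem wedge_blockCols_one_ne (hd : 0 < d) {i i' : Fin r} (h : i ≠ i') :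
    wedge (blockCols (1 : Matrix _ (BlockIdx d r) k) i) (fun l => (l, i')) = 0 :=
  wedge_blockCols_one_eq_zero_of_index ⟨0, hd⟩ h.symm

theorem blockTensor_one_diag (hd : 0 < d) (i : Fin r) :
    blockTensor (1 : Matrix _ (BlockIdx d r) k) (fun l => (l, i)) = 1 := by
  rw [blockTensor, Finset.sum_apply, Finset.sum_eq_single i]
  · exact wedge_blockCols_one_diag i
  · intro i' _ h
    exact wedge_blockCols_one_ne hd h
  · simp

/-- The positions other than `l` already fix the block and use up all its vectors but one, so only
`(l, i)` can fill the gap. These coefficients isolate single matrix entries. -/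
theorem blockTensor_one_update (hd : 2 ≤ d) (i : Fin r) (l : Fin d) (a : BlockIdx d r) :
    blockTensor (1 : Matrix _ (BlockIdx d r) k) (Function.update (fun l => (l, i)) l a) =
      if a = (l, i) then 1 else 0 := by
  split_ifs with h
  · subst h
    rw [Function.update_eq_self (f := fun l : Fin d => (l, i))]
    exact blockTensor_one_diag (by omega) i
  · have : Nontrivial (Fin d) := Fin.nontrivial_iff_two_le.2 hd
    obtain ⟨y, hy⟩ := exists_ne l
    by_cases ha : a.2 = i
    · rw [blockTensor, Finset.sum_apply]
      refine Finset.sum_eq_zero fun i' _ => ?_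
      by_cases hi : i' = i
      · subst hi
        rw [wedge_apply]
        have hal : a.1 ≠ l := fun h' => h (Prod.ext h' ha)
        refine Matrix.det_eq_zero_of_row_eq_zero l fun b => ?_
        simp only [Matrix.of_apply, blockCols, Matrix.col_apply]
        refine Matrix.one_apply_ne fun h' => ?_
        by_cases hb : b = l
        · subst hb; rw [Function.update_self] at h'; exact h h'
        · rw [Function.update_of_ne hb] at h'; exact hb (congrArg Prod.fst h')
      · refine wedge_blockCols_one_eq_zero_of_index y ?_
        rw [Function.update_of_ne hy]
        exact fun h' => hi h'.symm
    · refine blockTensor_one_eq_zero (x := l) (y := y) ?_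
      rw [Function.update_of_ne hy, Function.update_self]
      exact ha

/-- Coefficients of the wedge products of the blocks of an invertible matrix are unique. -/
theorem sum_smul_wedge_injective (hd : 0 < d) {M : Matrix (BlockIdx d r) (BlockIdx d r) k}
    (hM : IsUnit M.det) {x y : Fin r → k}
    (h : ∑ i, x i • wedge (blockCols M i) = ∑ i, y i • wedge (blockCols M i)) : x = y := by
  have key : ∀ (z : Fin r → k) (i : Fin r), multilinearMul (fun _ => M⁻¹)
      (∑ i, z i • wedge (blockCols M i)) (fun l => (l, i)) = z i := by
    intro z i
    simp only [multilinearMul_sum, multilinearMul_smul, multilinearMul_blockCols,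
      Matrix.nonsing_inv_mul M hM]
    rw [Finset.sum_apply, Finset.sum_eq_single i]
    · simp [wedge_blockCols_one_diag]
    · intro i' _ hi
      simp [wedge_blockCols_one_ne hd hi]
    · simp
  funext i
  rw [← key x i, h, key]

/-- Elements of the kernel are block diagonal in the basis given by the blocks. -/
theorem kappa_blockTensor_offDiag (hd : 3 ≤ d) {M X : Matrix (BlockIdx d r) (BlockIdx d r) k}
    (hM : IsUnit M.det) (hX : X ∈ kappa (blockTensor M)) {a b : BlockIdx d r} (hab : a.2 ≠ b.2) :
    (M⁻¹ * X * M) a b = 0 := by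
  have h0 : delta (blockTensor (1 : Matrix _ (BlockIdx d r) k)) (M⁻¹ * X * M) = 0 := by
    have h := delta_multilinearMul M⁻¹ M X (blockTensor M) (Matrix.nonsing_inv_mul M hM)
    rw [LinearMap.mem_ker.1 hX, multilinearMul_zero, multilinearMul_blockTensor,
      Matrix.nonsing_inv_mul M hM] at h
    exact h.symm
  obtain ⟨l, i⟩ := b
  -- At this coefficient the summand for position `l` is exactly the entry `(a, (l, i))`.
  have h1 := congrFun h0 (Function.update (fun l => (l, i)) l a)
  simp only [delta, LinearMap.coe_mk, AddHom.coe_mk, Finset.sum_apply, modeMul_apply,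
    Pi.zero_apply] at h1
  rw [Finset.sum_eq_single l, Finset.sum_eq_single (l, i)] at h1
  · simpa [blockTensor_one_diag (k := k) (by omega : 0 < d) i] using h1
  · intro c _ hc
    rw [Function.update_idem, blockTensor_one_update (by omega), if_neg hc, mul_zero]
  · simp
  · intro y _ hy
    -- Here `d ≥ 3` enters: position `l` lies in a foreign block, position `y` is being replaced,
    -- and a third position `z` still lies in block `i`, so the coefficient mixes two blocks.
    obtain ⟨z, hz⟩ : ∃ z : Fin d, z ∉ ({l, y} : Finset (Fin d)) := by
      by_contra! h
      have h2 := Finset.card_le_card (fun z _ => h z : Finset.univ ⊆ ({l, y} : Finset (Fin d)))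
      rw [Finset.card_univ, Fintype.card_fin] at h2
      have h3 := Finset.card_le_two (a := l) (b := y)
      omega
    simp only [Finset.mem_insert, Finset.mem_singleton, not_or] at hz
    refine Finset.sum_eq_zero fun c _ => ?_
    rw [blockTensor_one_eq_zero (x := l) (y := z), mul_zero]
    rw [Function.update_of_ne (Ne.symm hy), Function.update_self, Function.update_of_ne hz.2,
      Function.update_of_ne hz.1]
    exact hab
  · simp

/-- Block diagonal matrices with traceless blocks lie in the kernel. -/
theorem mem_kappa_blockTensor {M : Matrix (BlockIdx d r) (BlockIdx d r) k}
    (hM : IsUnit M.det) {Y : Matrix (BlockIdx d r) (BlockIdx d r) k}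
    (hY : ∀ a b, a.2 ≠ b.2 → Y a b = 0) (htr : ∀ i, ∑ l, Y (l, i) (l, i) = 0) :
    M * Y * M⁻¹ ∈ kappa (blockTensor M) := by
  have hcol : ∀ l i, (M * Y * M⁻¹) *ᵥ blockCols M i l =
      ∑ l', Y (l', i) (l, i) • blockCols M i l' := by
    intro l i
    have h1 : (M * Y * M⁻¹) *ᵥ blockCols M i l = (M * Y).col (l, i) := by
      change ((M * Y * M⁻¹) * M).col (l, i) = _
      rw [Matrix.mul_assoc, Matrix.nonsing_inv_mul M hM, Matrix.mul_one]
    rw [h1]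
    funext a
    simp only [Matrix.col_apply, Matrix.mul_apply, Fintype.sum_prod_type_right,
      Finset.sum_apply, Pi.smul_apply, smul_eq_mul, blockCols]
    rw [Finset.sum_eq_single i]
    · exact Finset.sum_congr rfl fun _ _ => mul_comm _ _
    · intro i' _ hi
      exact Finset.sum_eq_zero fun l' _ => by rw [hY _ _ hi, mul_zero]
    · simp
  refine LinearMap.mem_ker.2 ?_
  simp only [blockTensor, delta_sum, delta_wedge, hcol, wedge_update_sum]
  refine Finset.sum_eq_zero fun i _ => ?_
  -- The derivation multiplies the `i`-th wedge product by the trace of the `i`-th block.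
  rw [← Finset.sum_smul, htr, zero_smul]

end BlockTensor

/-! ### Polynomial functions as witnesses of genericity. -/

section PolynomialFunctions

variable (k : Type*) [Field k] (E : Type*) [AddCommGroup E] [Module k E]

/-- The algebra of polynomial functions on a vector space. -/
def polyFun : Subalgebra k (E → k) :=
  (MvPolynomial.aeval (R := k) fun (φ : Module.Dual k E) (x : E) => φ x).range

variable {k E}

theorem Generic.of_polyFun {X : Set E} {P : E → Prop} {f : E → k} (hf : f ∈ polyFun k E)
    (hne : ∃ x ∈ X, f x ≠ 0) (h : ∀ x ∈ X, f x ≠ 0 → P x) : Generic k X P := by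
  obtain ⟨p, rfl⟩ := hf
  have hp : ∀ x, MvPolynomial.aeval (R := k) (fun (φ : Module.Dual k E) (x : E) => φ x) p x =
      MvPolynomial.eval (fun φ : Module.Dual k E => φ x) p := by
    intro x
    have h := MvPolynomial.map_aeval (R := k) (fun (φ : Module.Dual k E) (x : E) => φ x)
      (Pi.evalRingHom (fun _ : E => k) x) p
    exact h
  refine ⟨p, ?_, ?_⟩
  · obtain ⟨x, hx, hne⟩ := hne
    exact ⟨x, hx, by rw [← hp]; exact hne⟩
  · intro x hx h'
    exact h x hx (by rw [← hp] at h'; exact h')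

theorem dual_mem_polyFun (φ : Module.Dual k E) : (fun x => φ x) ∈ polyFun k E :=
  ⟨MvPolynomial.X φ, by simp⟩

theorem sum_mem_polyFun {α : Type*} {s : Finset α} {f : α → E → k}
    (h : ∀ a ∈ s, f a ∈ polyFun k E) : (fun x => ∑ a ∈ s, f a x) ∈ polyFun k E := by
  convert! sum_mem h using 1
  ext x
  simp

theorem prod_mem_polyFun {α : Type*} {s : Finset α} {f : α → E → k}
    (h : ∀ a ∈ s, f a ∈ polyFun k E) : (fun x => ∏ a ∈ s, f a x) ∈ polyFun k E := by
  convert! prod_mem h using 1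
  ext x
  simp

theorem det_mem_polyFun {ν : Type*} [Fintype ν] [DecidableEq ν] {F : E → Matrix ν ν k}
    (h : ∀ a b, (fun x => F x a b) ∈ polyFun k E) : (fun x => (F x).det) ∈ polyFun k E := by
  simp only [Matrix.det_apply']
  exact sum_mem_polyFun fun σ _ => mul_mem (algebraMap_mem (polyFun k E) _)
    (prod_mem_polyFun fun a _ => h _ _)

theorem entry_pow_mem_polyFun {ν : Type*} [Fintype ν] [DecidableEq ν] (n : ℕ) (a b : ν) :
    (fun K : Matrix ν ν k => (K ^ n) a b) ∈ polyFun k (Matrix ν ν k) := by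
  induction n generalizing b with
  | zero => exact algebraMap_mem (polyFun k (Matrix ν ν k)) _
  | succ n ih =>
    simp only [pow_succ, Matrix.mul_apply]
    exact sum_mem_polyFun fun c _ => mul_mem (ih c)
      (dual_mem_polyFun (Matrix.entryLinearMap k k c b))

end PolynomialFunctions

/-! ### Simple spectrum as a polynomial condition. -/

section TraceHankel

variable {ν : Type*} [Fintype ν] [DecidableEq ν]

/-- The Hankel matrix of power traces; its determinant is the discriminant of the
characteristic polynomial. -/
def traceHankel {R : Type*} [CommRing R] (K : Matrix ν ν R) :
    Matrix (Fin (Fintype.card ν)) (Fin (Fintype.card ν)) R :=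
  Matrix.of fun i j => (K ^ (i.val + j.val)).trace

theorem traceHankel_map {R S : Type*} [CommRing R] [CommRing S] (f : R →+* S)
    (K : Matrix ν ν R) : traceHankel (K.map f) = (traceHankel K).map f := by
  ext i j
  simp only [traceHankel, Matrix.of_apply, Matrix.map_apply, Matrix.trace, map_sum,
    Matrix.diag_apply]
  rw [← Matrix.map_pow]
  rfl

theorem det_traceHankel_mem_polyFun {k : Type*} [Field k] :
    (fun K : Matrix ν ν k => (traceHankel K).det) ∈ polyFun k (Matrix ν ν k) :=
  det_mem_polyFun fun _ _ => sum_mem_polyFun fun a _ => entry_pow_mem_polyFun _ a a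

variable {L : Type*} [Field L]

theorem conj_diagonal_pow {W : Matrix ν ν L} (hW : IsUnit W.det) (D : ν → L) (n : ℕ) :
    (W * Matrix.diagonal D * W⁻¹) ^ n = W * Matrix.diagonal (D ^ n) * W⁻¹ := by
  induction n with
  | zero => simp [Matrix.mul_nonsing_inv W hW]
  | succ n ih =>
    rw [pow_succ, ih, pow_succ D, show Matrix.diagonal (D ^ n * D) =
      Matrix.diagonal (D ^ n) * Matrix.diagonal D from (Matrix.diagonal_mul_diagonal _ _).symm]
    simp only [Matrix.mul_assoc]
    rw [← Matrix.mul_assoc W⁻¹ W, Matrix.nonsing_inv_mul W hW, Matrix.one_mul]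

/-- Traces of powers are power sums of the eigenvalues, so the Hankel matrix is `VᵀV` for a
Vandermonde matrix `V`. -/
theorem det_traceHankel_ne_zero_iff {W : Matrix ν ν L} (hW : IsUnit W.det) (D : ν → L) :
    (traceHankel (W * Matrix.diagonal D * W⁻¹)).det ≠ 0 ↔ Function.Injective D := by
  have e := Fintype.equivFin ν
  have h : traceHankel (W * Matrix.diagonal D * W⁻¹) =
      (Matrix.vandermonde (D ∘ e.symm))ᵀ * Matrix.vandermonde (D ∘ e.symm) := by
    ext i j
    rw [traceHankel, Matrix.of_apply, conj_diagonal_pow hW, Matrix.trace_mul_comm,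
      ← Matrix.mul_assoc, Matrix.nonsing_inv_mul W hW, Matrix.one_mul, Matrix.trace_diagonal,
      Matrix.mul_apply, ← Equiv.sum_comp e.symm]
    simp [Matrix.vandermonde_apply, pow_add]
  rw [h, Matrix.det_mul, Matrix.det_transpose, mul_self_ne_zero,
    Matrix.det_vandermonde_ne_zero_iff]
  exact Function.Injective.of_comp_iff' D e.symm.bijective

/-- With too few distinct eigenvalues, the product `q` of their linear factors has degree below the
matrix size while `q(K)` is nilpotent. All traces of `K ^ i * q(K)` then vanish, so the coefficients
of `q` form a nonzero kernel vector of the Hankel matrix. -/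
theorem card_le_card_roots_charpoly [DecidableEq L] [IsAlgClosed L] {K : Matrix ν ν L}
    (h : (traceHankel K).det ≠ 0) :
    Fintype.card ν ≤ K.charpoly.roots.toFinset.card := by
  by_contra! hlt
  set S := K.charpoly.roots.toFinset
  set q : Polynomial L := ∏ x ∈ S, (Polynomial.X - Polynomial.C x)
  have hq : q.Monic := Polynomial.monic_prod_of_monic _ _ fun x _ => Polynomial.monic_X_sub_C x
  have hdeg : q.natDegree = S.card := by
    rw [Polynomial.natDegree_prod_of_monic _ _ fun x _ => Polynomial.monic_X_sub_C x]
    simp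
  have hnil : IsNilpotent (Polynomial.aeval K q) := by
    refine ⟨Multiset.card K.charpoly.roots, ?_⟩
    rw [← map_pow]
    have hdvd : K.charpoly ∣ q ^ Multiset.card K.charpoly.roots := by
      rw [← Finset.prod_pow]
      conv_lhs => rw [(IsAlgClosed.splits K.charpoly).eq_prod_roots_of_monic K.charpoly_monic,
        Finset.prod_multiset_map_count]
      exact Finset.prod_dvd_prod_of_dvd _ _ fun x _ =>
        pow_dvd_pow _ (Multiset.count_le_card _ _)
    obtain ⟨g, hg⟩ := hdvd
    rw [hg, map_mul, Matrix.aeval_self_charpoly, zero_mul]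
  have hker : traceHankel K *ᵥ (fun j => q.coeff j.val) = 0 := by
    funext i
    have hn : (K ^ i.val * Polynomial.aeval K q).trace = 0 := by
      refine (Matrix.isNilpotent_trace_of_isNilpotent ?_).eq_zero
      refine Commute.isNilpotent_mul_left ?_ hnil
      exact Commute.pow_left (by simpa using (Commute.all Polynomial.X q).map (Polynomial.aeval K)) _
    rw [Polynomial.aeval_eq_sum_range' (n := Fintype.card ν) (by omega), Finset.mul_sum,
      Matrix.trace_sum, ← Fin.sum_univ_eq_sum_range
        (fun j => (K ^ i.val * q.coeff j • K ^ j).trace)] at hn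
    rw [Pi.zero_apply, ← hn]
    simp [Matrix.mulVec, dotProduct, traceHankel, pow_add, mul_comm]
  have hz := Matrix.eq_zero_of_mulVec_eq_zero h hker
  refine hq.ne_zero (Polynomial.ext fun j => ?_)
  by_cases hj : j < Fintype.card ν
  · exact congrFun hz ⟨j, hj⟩
  · exact Polynomial.coeff_eq_zero_of_natDegree_lt (by omega)

theorem exists_diagonalization [IsAlgClosed L] {K : Matrix ν ν L}
    (h : (traceHankel K).det ≠ 0) :
    ∃ (W : Matrix ν ν L) (D : ν → L), IsUnit W.det ∧ K = W * Matrix.diagonal D * W⁻¹ := by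
  classical
  obtain ⟨D⟩ : Nonempty (ν ↪ K.charpoly.roots.toFinset) :=
    Function.Embedding.nonempty_of_card_le (by
      rw [Fintype.card_coe]; exact card_le_card_roots_charpoly h)
  have hD : Function.Injective fun a => (D a : L) := Subtype.val_injective.comp D.injective
  have hv : ∀ a, ∃ v : ν → L, v ≠ 0 ∧ K *ᵥ v = (D a : L) • v := by
    intro a
    have ha : K.charpoly.IsRoot (D a : L) :=
      Polynomial.isRoot_of_mem_roots (Multiset.mem_toFinset.1 (D a).2)
    rw [Polynomial.IsRoot, Matrix.eval_charpoly] at ha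
    obtain ⟨v, hv, h0⟩ := Matrix.exists_mulVec_eq_zero_iff.2 ha
    refine ⟨v, hv, ?_⟩
    rw [Matrix.sub_mulVec, sub_eq_zero] at h0
    rw [← h0]
    simp
  choose v hv0 hv using hv
  have hli : LinearIndependent L v :=
    Module.End.eigenvectors_linearIndependent' (Matrix.toLin' K) _ hD v fun a =>
      ⟨Module.End.mem_eigenspace_iff.2 (by simpa using hv a), hv0 a⟩
  let W : Matrix ν ν L := Matrix.of fun a b => v b a
  have hW : IsUnit W.det := by
    rw [← Matrix.isUnit_iff_isUnit_det, ← Matrix.linearIndependent_cols_iff_isUnit]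
    exact hli
  refine ⟨W, fun a => D a, hW, ?_⟩
  have hKW : K * W = W * Matrix.diagonal fun a => (D a : L) := by
    ext a b
    rw [Matrix.mul_diagonal]
    have := congrFun (hv b) a
    rw [Pi.smul_apply, smul_eq_mul, mul_comm] at this
    exact this
  rw [← hKW, Matrix.mul_assoc, Matrix.mul_nonsing_inv W hW, Matrix.mul_one]

end TraceHankel

/-! ### Each eigenvector belongs to one block. -/

section Labels

variable {L : Type*} [Field L] {d r : ℕ}

/-- The indicator matrix of the `i`-th block. -/
def blockIndicator (L : Type*) [Field L] {d r : ℕ} (i : Fin r) :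
    Matrix (BlockIdx d r) (BlockIdx d r) L :=
  Matrix.diagonal fun a => if a.2 = i then 1 else 0

theorem blockIndicator_mul_self (i : Fin r) :
    blockIndicator L (d := d) i * blockIndicator L i = blockIndicator L i := by
  simp [blockIndicator, Matrix.diagonal_mul_diagonal]

theorem blockIndicator_mul_of_ne {i j : Fin r} (h : i ≠ j) :
    blockIndicator L (d := d) i * blockIndicator L j = 0 := by
  rw [blockIndicator, blockIndicator, Matrix.diagonal_mul_diagonal, ← Matrix.diagonal_zero]
  congr 1
  funext a
  by_cases ha : a.2 = i
  · simp [ha, h]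
  · simp [ha]

theorem sum_blockIndicator : ∑ i, blockIndicator L (d := d) (r := r) i = 1 := by
  ext a b
  rw [Matrix.sum_apply]
  by_cases h : a = b
  · subst h; simp [blockIndicator]
  · simp [blockIndicator, h]

theorem card_filter_snd_eq (i : Fin r) :
    (Finset.univ.filter fun a : BlockIdx d r => a.2 = i).card = d := by
  refine Eq.trans (Eq.symm ?_) (Finset.card_fin d)
  refine Finset.card_bij (fun l _ => (l, i)) (by simp) (by simp) ?_
  rintro ⟨l, j⟩ h
  simp only [Finset.mem_filter_univ] at h
  exact ⟨l, Finset.mem_univ _, by rw [h]⟩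

theorem trace_blockIndicator (i : Fin r) : (blockIndicator L (d := d) i).trace = d := by
  rw [blockIndicator, Matrix.trace_diagonal, Finset.sum_boole, card_filter_snd_eq]

theorem trace_blockIndicator_mul (i : Fin r) (Y : Matrix (BlockIdx d r) (BlockIdx d r) L) :
    (blockIndicator L i * Y).trace = ∑ l, Y (l, i) (l, i) := by
  simp [blockIndicator, Matrix.trace, Matrix.diagonal_mul, Fintype.sum_prod_type]

/-- Commuting with the block projections is a form of block diagonality that survives a change of
basis. -/
theorem commute_blockIndicator_iff {Y : Matrix (BlockIdx d r) (BlockIdx d r) L} :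
    (∀ i, Commute (blockIndicator L i) Y) ↔ ∀ a b, a.2 ≠ b.2 → Y a b = 0 := by
  constructor
  · intro h a b hab
    have h1 := congrFun (congrFun (h a.2) a) b
    simpa [blockIndicator, Matrix.diagonal_mul, Matrix.mul_diagonal, hab.symm] using h1
  · intro h i
    ext a b
    simp only [blockIndicator, Matrix.diagonal_mul, Matrix.mul_diagonal]
    by_cases hab : a.2 = b.2
    · rw [hab, mul_comm]
    · rw [h a b hab, mul_zero, zero_mul]

theorem conj_conj_inv {ν : Type*} [Fintype ν] [DecidableEq ν] {N X Y : Matrix ν ν L}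
    (hN : IsUnit N.det) : (N⁻¹ * X * N) * (N⁻¹ * Y * N) = N⁻¹ * (X * Y) * N := by
  simp only [Matrix.mul_assoc]
  rw [← Matrix.mul_assoc N N⁻¹, Matrix.mul_nonsing_inv N hN, Matrix.one_mul]

/-- If a matrix with simple spectrum is block diagonal with respect to the blocks of `M`, then each
of its eigenvectors lies in the span of one block. Here `N = M⁻¹ W` expresses the eigenvectors in
the basis given by the blocks. -/
theorem exists_labels [CharZero L] {N : Matrix (BlockIdx d r) (BlockIdx d r) L}
    (hN : IsUnit N.det) {D : BlockIdx d r → L} (hD : Function.Injective D)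
    (hY : ∀ a b, a.2 ≠ b.2 → (N * Matrix.diagonal D * N⁻¹) a b = 0) :
    ∃ c : BlockIdx d r → Fin r,
      (∀ i, N⁻¹ * blockIndicator L i * N = Matrix.diagonal fun a => if c a = i then 1 else 0) ∧
      ∀ i, (Finset.univ.filter fun a => c a = i).card = d := by
  set Q : Fin r → Matrix (BlockIdx d r) (BlockIdx d r) L :=
    fun i => N⁻¹ * blockIndicator L i * N with hQ
  -- A matrix commuting with a diagonal matrix with distinct entries is itself diagonal.
  have hoff : ∀ i a b, a ≠ b → Q i a b = 0 := by
    intro i a b hab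
    have h1 := commute_blockIndicator_iff.2 hY i
    have h2 : Q i * Matrix.diagonal D = Matrix.diagonal D * Q i := by
      have h3 : Matrix.diagonal D = N⁻¹ * (N * Matrix.diagonal D * N⁻¹) * N := by
        simp only [Matrix.mul_assoc, Matrix.nonsing_inv_mul N hN, Matrix.mul_one]
        rw [← Matrix.mul_assoc, Matrix.nonsing_inv_mul N hN, Matrix.one_mul]
      rw [h3, conj_conj_inv hN, conj_conj_inv hN, h1.eq]
    have h4 := congrFun (congrFun h2 a) b
    rw [Matrix.mul_diagonal, Matrix.diagonal_mul, mul_comm, ← sub_eq_zero, ← sub_mul] at h4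
    exact (mul_eq_zero.1 h4).resolve_left (sub_ne_zero.2 fun h => hab (hD h.symm))
  have hdiag : ∀ i, Q i = Matrix.diagonal fun a => Q i a a := by
    intro i
    ext a b
    by_cases h : a = b
    · subst h; simp
    · rw [Matrix.diagonal_apply_ne _ h, hoff i a b h]
  have hmul : ∀ i j a, (Q i * Q j) a a = Q i a a * Q j a a := by
    intro i j a
    rw [hdiag i, hdiag j, Matrix.diagonal_mul_diagonal]
    simp
  have hsum : ∀ a, ∑ i, Q i a a = 1 := by
    intro a
    have h1 : ∑ i, Q i = 1 := by
      rw [hQ, ← Finset.sum_mul, ← Finset.mul_sum, sum_blockIndicator, Matrix.mul_one,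
        Matrix.nonsing_inv_mul N hN]
    have h2 := congrFun (congrFun h1 a) a
    rwa [Matrix.sum_apply, Matrix.one_apply_eq] at h2
  -- The diagonal entries are idempotents of a field that sum to one over `i`.
  have hex : ∀ a, ∃ i, Q i a a = 1 := by
    intro a
    obtain ⟨i, -, hi⟩ := Finset.exists_ne_zero_of_sum_ne_zero
      (by rw [hsum a]; exact one_ne_zero : ∑ i, Q i a a ≠ 0)
    refine ⟨i, ?_⟩
    have h1 := hmul i i a
    rw [hQ] at h1
    rw [conj_conj_inv hN, blockIndicator_mul_self] at h1
    exact mul_right_cancel₀ hi (by rw [one_mul]; exact h1.symm)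
  choose c hc using hex
  have hval : ∀ i, Q i = Matrix.diagonal fun a => if c a = i then 1 else 0 := by
    intro i
    rw [hdiag i]
    congr 1
    funext a
    split_ifs with h
    · rw [← h, hc]
    · have h1 := hmul i (c a) a
      rw [hc, mul_one] at h1
      rw [← h1, hQ]
      rw [conj_conj_inv hN, blockIndicator_mul_of_ne (Ne.symm h)]
      simp
  refine ⟨c, hval, fun i => ?_⟩
  -- The trace counts the eigenvectors with label `i`; characteristic zero turns this into an
  -- equality of natural numbers.
  have h1 : (Q i).trace = d := by
    rw [hQ, Matrix.trace_mul_comm, ← Matrix.mul_assoc, Matrix.mul_nonsing_inv N hN,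
      Matrix.one_mul, trace_blockIndicator]
  rw [hval, Matrix.trace_diagonal, Finset.sum_boole] at h1
  exact_mod_cast h1

variable {N : Matrix (BlockIdx d r) (BlockIdx d r) L} {c : BlockIdx d r → Fin r}

/-- Conjugates of block diagonal matrices are block diagonal with respect to the labels. -/
theorem conj_eq_zero_of_label_ne (hN : IsUnit N.det)
    (hc : ∀ i, N⁻¹ * blockIndicator L i * N = Matrix.diagonal fun a => if c a = i then 1 else 0)
    {Y : Matrix (BlockIdx d r) (BlockIdx d r) L} (hY : ∀ a b, a.2 ≠ b.2 → Y a b = 0)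
    {a b : BlockIdx d r} (hab : c a ≠ c b) : (N⁻¹ * Y * N) a b = 0 := by
  have h1 : (N⁻¹ * blockIndicator L (c a) * N) * (N⁻¹ * Y * N) =
      (N⁻¹ * Y * N) * (N⁻¹ * blockIndicator L (c a) * N) := by
    rw [conj_conj_inv hN, conj_conj_inv hN, (commute_blockIndicator_iff.2 hY _).eq]
  have h2 := congrFun (congrFun h1 a) b
  rw [hc, Matrix.diagonal_mul, Matrix.mul_diagonal, if_pos rfl, if_neg hab.symm, one_mul,
    mul_zero] at h2
  exact h2

/-- Block diagonal matrices with traceless blocks realize every off-diagonal entry between two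
eigenvectors with the same label. -/
theorem exists_conj_ne_zero (hN : IsUnit N.det)
    (hc : ∀ i, N⁻¹ * blockIndicator L i * N = Matrix.diagonal fun a => if c a = i then 1 else 0)
    {a b : BlockIdx d r} (hab : a ≠ b) (hlab : c a = c b) :
    ∃ Y : Matrix (BlockIdx d r) (BlockIdx d r) L, (∀ x y, x.2 ≠ y.2 → Y x y = 0) ∧
      (∀ i, ∑ l, Y (l, i) (l, i) = 0) ∧ (N⁻¹ * Y * N) a b ≠ 0 := by
  have hN' := Matrix.nonsing_inv_mul N hN
  have hE : ∀ i, blockIndicator L i =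
      N * (Matrix.diagonal fun a => if c a = i then 1 else 0) * N⁻¹ := by
    intro i
    rw [← hc]
    simp only [Matrix.mul_assoc, Matrix.mul_nonsing_inv N hN, Matrix.mul_one]
    rw [← Matrix.mul_assoc, Matrix.mul_nonsing_inv N hN, Matrix.one_mul]
  have hmul : ∀ X Z : Matrix (BlockIdx d r) (BlockIdx d r) L,
      (N * X * N⁻¹) * (N * Z * N⁻¹) = N * (X * Z) * N⁻¹ := by
    intro X Z
    simp only [Matrix.mul_assoc]
    rw [← Matrix.mul_assoc N⁻¹ N, hN', Matrix.one_mul]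
  have hdl : ∀ q : BlockIdx d r → L,
      Matrix.diagonal q * Matrix.single a b 1 = Matrix.single a b (q a) := by
    intro q
    ext x y
    rw [Matrix.diagonal_mul, Matrix.single_apply, Matrix.single_apply]
    aesop
  have hdr : ∀ q : BlockIdx d r → L,
      Matrix.single a b 1 * Matrix.diagonal q = Matrix.single a b (q b) := by
    intro q
    ext x y
    rw [Matrix.mul_diagonal, Matrix.single_apply, Matrix.single_apply]
    aesop
  -- A matrix unit in the eigenbasis: equal labels make it commute with the block projections, and
  -- `a ≠ b` makes its block traces vanish.
  refine ⟨N * Matrix.single a b 1 * N⁻¹, commute_blockIndicator_iff.1 fun i => ?_, fun i => ?_, ?_⟩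
  · rw [Commute, SemiconjBy, hE, hmul, hmul, hdl, hdr, hlab]
  · rw [← trace_blockIndicator_mul, hE, hmul, Matrix.trace_mul_comm, ← Matrix.mul_assoc, hN',
      Matrix.one_mul, hdl]
    exact Matrix.trace_single_eq_of_ne _ _ _ hab
  · have h : N⁻¹ * (N * Matrix.single a b 1 * N⁻¹) * N = Matrix.single a b (1 : L) := by
      simp only [Matrix.mul_assoc, hN', Matrix.mul_one]
      rw [← Matrix.mul_assoc, hN', Matrix.one_mul]
    rw [h, Matrix.single_apply_same]
    exact one_ne_zero

end Labels

/-! ### Descent of nonvanishing to the base field. -/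

section Descent

variable {k L : Type*} [Field k] [Field L] [Algebra k L] {d r : ℕ}

/-- A linear form on matrices over `L` that does not vanish at some block diagonal matrix with
traceless blocks does not vanish at some such matrix over the smaller field. -/
theorem exists_descent (f : Matrix (BlockIdx d r) (BlockIdx d r) L →ₗ[L] L)
    {Y : Matrix (BlockIdx d r) (BlockIdx d r) L} (hY : ∀ x y, x.2 ≠ y.2 → Y x y = 0)
    (htr : ∀ i, ∑ l, Y (l, i) (l, i) = 0) (hf : f Y ≠ 0) :
    ∃ Z : Matrix (BlockIdx d r) (BlockIdx d r) k, (∀ x y, x.2 ≠ y.2 → Z x y = 0) ∧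
      (∀ i, ∑ l, Z (l, i) (l, i) = 0) ∧ f (Z.map (algebraMap k L)) ≠ 0 := by
  classical
  let β := Module.Basis.ofVectorSpace k L
  let S := Finset.univ.biUnion fun p : BlockIdx d r × BlockIdx d r =>
    (β.repr (Y p.1 p.2)).support
  let Z := fun s => Y.map fun y => β.repr y s
  -- The coordinate matrices of `Y` in a `k`-basis of `L` inherit its `k`-linear conditions, and `f`
  -- cannot kill all of them.
  have hsum : Y = ∑ s ∈ S, β s • (Z s).map (algebraMap k L) := by
    ext x y
    rw [Matrix.sum_apply]
    conv_lhs => rw [← β.linearCombination_repr (Y x y)]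
    rw [Finsupp.linearCombination_apply, Finsupp.sum_of_support_subset (s := S)]
    · refine Finset.sum_congr rfl fun s _ => ?_
      simp [Z, Algebra.smul_def, mul_comm]
    · exact Finset.subset_biUnion_of_mem
        (fun p : BlockIdx d r × BlockIdx d r => (β.repr (Y p.1 p.2)).support)
        (Finset.mem_univ (x, y))
    · simp
  rw [hsum, map_sum] at hf
  obtain ⟨s, -, hs⟩ := Finset.exists_ne_zero_of_sum_ne_zero hf
  rw [map_smul, smul_eq_mul] at hs
  refine ⟨Z s, fun x y h => ?_, fun i => ?_, right_ne_zero_of_mul hs⟩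
  · simp [Z, hY x y h]
  · have h := congrArg (fun y => β.repr y s) (htr i)
    simpa [Z, map_sum, Finsupp.finsetSum_apply] using h

end Descent

/-! ### A traceless diagonal matrix with simple spectrum. -/

section TracelessWitness

/-- Pairwise distinct numbers that add up to zero in every block. -/
theorem exists_injective_traceless (k : Type*) [Field k] [CharZero k] (d r : ℕ) (hd : 2 ≤ d) :
    ∃ D : BlockIdx d r → k, Function.Injective D ∧ ∀ i, ∑ l, D (l, i) = 0 := by
  obtain ⟨n, rfl⟩ : ∃ n, d = n + 1 := ⟨d - 1, by omega⟩
  -- Block `i` receives the positive integers `n i + 1, …, n i + n` and minus their sum. The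
  -- negative entries are distinct because the sums increase strictly with `i`.
  let u : Fin n → Fin r → ℤ := fun l i => n * i + l + 1
  let D : BlockIdx (n + 1) r → ℤ := fun a =>
    Fin.lastCases (motive := fun _ => ℤ) (-∑ l, u l a.2) (fun l => u l a.2) a.1
  have hpos : ∀ l i, 0 < u l i := fun l i => by positivity
  have hn : (Finset.univ : Finset (Fin n)).Nonempty := ⟨⟨0, by omega⟩, Finset.mem_univ _⟩
  have hspos : ∀ i, 0 < ∑ l, u l i := fun i => Finset.sum_pos (fun l _ => hpos l i) hn
  have hmono : StrictMono fun i => ∑ l, u l i := by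
    intro i j hij
    refine Finset.sum_lt_sum_of_nonempty hn fun l _ => ?_
    have h1 : (i : ℤ) < j := by exact_mod_cast hij
    have h2 : (0 : ℤ) < n := by omega
    have h3 := mul_lt_mul_of_pos_left h1 h2
    simp only [u]
    omega
  have hD : Function.Injective D := by
    rintro ⟨a, i⟩ ⟨b, j⟩ h
    induction a using Fin.lastCases with
    | last =>
      induction b using Fin.lastCases with
      | last =>
        simp only [D, Fin.lastCases_last, neg_inj] at h
        rw [hmono.injective h]
      | cast b =>
        simp only [D, Fin.lastCases_last, Fin.lastCases_castSucc] at h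
        linarith [hpos b j, hspos i]
    | cast a =>
      induction b using Fin.lastCases with
      | last =>
        simp only [D, Fin.lastCases_last, Fin.lastCases_castSucc] at h
        linarith [hpos a i, hspos j]
      | cast b =>
        simp only [D, Fin.lastCases_castSucc, u] at h
        have ha := a.isLt
        have hb := b.isLt
        have h' : a.val + n * i.val = b.val + n * j.val := by
          zify; linarith
        have h1 : a.val = b.val := by
          have := congrArg (· % n) h'
          simpa [Nat.add_mul_mod_self_left, Nat.mod_eq_of_lt ha, Nat.mod_eq_of_lt hb] using this
        have h2 : i.val = j.val := by
          have h3 : n * i.val = n * j.val := by omega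
          exact Nat.eq_of_mul_eq_mul_left (by omega) h3
        rw [Fin.ext h1, Fin.ext h2]
  refine ⟨fun a => (D a : k), fun a b h => hD (Int.cast_injective h), fun i => ?_⟩
  have h : ∑ l, D (l, i) = 0 := by
    simp only [D, Fin.sum_univ_castSucc, Fin.lastCases_last, Fin.lastCases_castSucc]
    ring
  simp only [← Int.cast_sum, h, Int.cast_zero]

end TracelessWitness

/-! ### Permutations that sort the eigenvectors by label. -/

section Partition

variable {L : Type*} [Field L] {d r : ℕ}

theorem mul_permMatrix_apply {ι ν : Type*} [Fintype ν] [DecidableEq ν] (W : Matrix ι ν L)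
    (π : Equiv.Perm ν) : W * π.permMatrix L = W.submatrix id π.symm := by
  rw [Equiv.Perm.permMatrix, PEquiv.mul_toMatrix_toPEquiv]

theorem permMatrix_conj {ν : Type*} [Fintype ν] [DecidableEq ν] (C : Matrix ν ν L)
    (π : Equiv.Perm ν) :
    (π.permMatrix L)ᵀ * C * π.permMatrix L = C.submatrix π.symm π.symm := by
  rw [mul_permMatrix_apply]
  ext a b
  simp [Matrix.mul_apply, Equiv.Perm.permMatrix, PEquiv.toMatrix_apply]

variable {c : BlockIdx d r → Fin r}

theorem exists_perm_label (hcard : ∀ i, (Finset.univ.filter fun a => c a = i).card = d) :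
    ∃ ρ : Equiv.Perm (BlockIdx d r), ∀ a, c (ρ a) = a.2 := by
  have e : ∀ i, Nonempty (Fin d ≃ {a // c a = i}) := fun i =>
    Fintype.card_eq.1 (by rw [Fintype.card_fin, Fintype.card_subtype, hcard])
  let f : BlockIdx d r → BlockIdx d r := fun a => ((e a.2).some a.1).1
  have hf : ∀ a, c (f a) = a.2 := fun a => ((e a.2).some a.1).2
  have hinj : Function.Injective f := by
    rintro ⟨l, i⟩ ⟨l', i'⟩ h
    obtain rfl : i = i' := (hf (l, i)).symm.trans ((congrArg c h).trans (hf (l', i')))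
    exact Prod.ext ((e i).some.injective (Subtype.ext h)) rfl
  exact ⟨Equiv.ofBijective f (Finite.injective_iff_bijective.1 hinj), hf⟩

/-- A permutation that brings a matrix into block diagonal form groups the indices according to
their labels if all off-diagonal entries between indices with the same label are nonzero. -/
theorem exists_perm_of_blockDiagonal (hd : 0 < d)
    (hcard : ∀ i, (Finset.univ.filter fun a => c a = i).card = d)
    {C : Matrix (BlockIdx d r) (BlockIdx d r) L} (hC : ∀ a b, a ≠ b → c a = c b → C a b ≠ 0)
    {ρ : Equiv.Perm (BlockIdx d r)} (hρ : ∀ a b, a.2 ≠ b.2 → C (ρ a) (ρ b) = 0) :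
    ∃ τ : Equiv.Perm (Fin r), ∀ a, c (ρ a) = τ a.2 := by
  have h1 : ∀ a b, c (ρ a) = c (ρ b) → a.2 = b.2 := by
    intro a b h
    by_contra hne
    exact hC (ρ a) (ρ b) (fun h' => hne (by rw [ρ.injective h'])) h (hρ a b hne)
  have h2 : ∀ a b, a.2 = b.2 → c (ρ a) = c (ρ b) := by
    intro a b h
    have hsub : (Finset.univ.filter fun z => c (ρ z) = c (ρ a)) ⊆
        Finset.univ.filter fun z : BlockIdx d r => z.2 = a.2 := by
      intro z hz
      rw [Finset.mem_filter] at hz ⊢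
      exact ⟨hz.1, h1 _ _ hz.2⟩
    have hc1 : (Finset.univ.filter fun z => c (ρ z) = c (ρ a)).card = d := by
      refine Eq.trans ?_ (hcard (c (ρ a)))
      exact Finset.card_equiv ρ (by simp)
    -- A label class lies inside one block, and both have `d` elements.
    have heq := Finset.eq_of_subset_of_card_le hsub (by rw [hc1, card_filter_snd_eq])
    have hb : b ∈ Finset.univ.filter fun z => c (ρ z) = c (ρ a) := by
      rw [heq, Finset.mem_filter]
      exact ⟨Finset.mem_univ _, h.symm⟩
    exact (Finset.mem_filter.1 hb).2.symm
  have hinj : Function.Injective fun i => c (ρ (⟨0, hd⟩, i)) := fun i j h => h1 _ _ h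
  exact ⟨Equiv.ofBijective _ (Finite.injective_iff_bijective.1 hinj), fun a => h2 _ _ rfl⟩

end Partition

/-! ### Equal spans give proportional wedge products. -/

section Refinement

variable {L : Type*} [Field L] {d r : ℕ}

/-- The refined blocks are the blocks of `M`, in some order, up to invertible factors. -/
theorem exists_wedge_eq_of_span {M W : Matrix (BlockIdx d r) (BlockIdx d r) L}
    (hM : IsUnit M.det) (hW : IsUnit W.det) {i : Fin r}
    {w : Fin d → BlockIdx d r} (hw : Function.Injective w)
    (hmem : ∀ l, (blockIndicator L i * (M⁻¹ * W)).col (w l) = (M⁻¹ * W).col (w l))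
    {v : Fin d → BlockIdx d r → L}
    (hv : Submodule.span L (Set.range v) = Submodule.span L (Set.range fun l => W.col (w l))) :
    ∃ g : L, g ≠ 0 ∧ wedge v = g • wedge (blockCols M i) := by
  have hli : LinearIndependent L v := by
    rw [linearIndependent_iff_card_eq_finrank_span, Set.finrank, hv, ← Set.finrank,
      ← linearIndependent_iff_card_eq_finrank_span]
    have h1 : LinearIndependent L W.col := by
      rw [Matrix.linearIndependent_cols_iff_isUnit, Matrix.isUnit_iff_isUnit_det]
      exact hW
    exact h1.comp w hw
  have hfix : ∀ l, blockIndicator L i *ᵥ (M⁻¹ *ᵥ v l) = M⁻¹ *ᵥ v l := by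
    intro l
    -- Being fixed by the block projection is a linear condition, so it passes from the eigenvectors
    -- to every vector of their span.
    have h1 : Submodule.span L (Set.range fun l => W.col (w l)) ≤
        LinearMap.eqLocus (Matrix.toLin' (blockIndicator L i * M⁻¹)) (Matrix.toLin' M⁻¹) := by
      rw [Submodule.span_le]
      rintro _ ⟨l, rfl⟩
      have h2 := hmem l
      rw [← Matrix.mul_assoc] at h2
      exact h2
    have h3 := h1 (hv ▸ Submodule.subset_span (Set.mem_range_self l) :
      v l ∈ Submodule.span L (Set.range fun l => W.col (w l)))
    simpa using h3
  let G : Matrix (Fin d) (Fin d) L := Matrix.of fun a l => (M⁻¹ *ᵥ v l) (a, i)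
  have hG : Matrix.of (fun x l => v l x) = M.submatrix id (fun a => (a, i)) * G := by
    ext x l
    have h1 : v l = M *ᵥ (blockIndicator L i *ᵥ (M⁻¹ *ᵥ v l)) := by
      rw [hfix, Matrix.mulVec_mulVec, Matrix.mul_nonsing_inv M hM, Matrix.one_mulVec]
    rw [Matrix.of_apply, h1]
    rw [Matrix.mulVec, dotProduct, Fintype.sum_prod_type_right, Finset.sum_eq_single i]
    · simp [blockIndicator, Matrix.mulVec_diagonal, Matrix.mul_apply, G]
    · intro j _ hj
      refine Finset.sum_eq_zero fun a _ => ?_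
      simp [blockIndicator, Matrix.mulVec_diagonal, hj]
    · simp
  refine ⟨G.det, fun h0 => ?_, ?_⟩
  · obtain ⟨u, hu, hGu⟩ := Matrix.exists_mulVec_eq_zero_iff.2 h0
    have h1 : Matrix.of (fun x l => v l x) *ᵥ u = 0 := by
      rw [hG, ← Matrix.mulVec_mulVec, hGu, Matrix.mulVec_zero]
    refine hu (funext fun l => Fintype.linearIndependent_iff.1 hli u ?_ l)
    funext x
    have := congrFun h1 x
    simpa [Matrix.mulVec, dotProduct, mul_comm] using this
  · have h1 := wedge_mul (M.submatrix id fun a => (a, i)) G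
    rw [← hG] at h1
    exact h1

end Refinement

/-! ### A flattening minor that certifies independence and rank. -/

section Pivot

variable {k : Type*} [Field k] {d r s : ℕ} {ι : Type*}

theorem span_col_mul_le {α β γ : Type*} [Fintype β] [Fintype γ] (A : Matrix α β k)
    (B : Matrix β γ k) :
    Submodule.span k (Set.range (A * B).col) ≤ Submodule.span k (Set.range A.col) := by
  rw [← Matrix.range_mulVecLin, ← Matrix.range_mulVecLin, Matrix.mulVecLin_mul]
  exact LinearMap.range_comp_le_range _ _

theorem blockTensor_submatrix {κ : Type*} (V : Matrix ι (BlockIdx d r) k) (f : κ → ι)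
    (j : Fin d → κ) : blockTensor V (f ∘ j) = blockTensor (V.submatrix f id) j := by
  simp only [blockTensor, Finset.sum_apply]
  rfl

theorem blockTensor_comp_perm (V : Matrix ι (BlockIdx d r) k) (j : Fin d → ι)
    (σ : Equiv.Perm (Fin d)) :
    blockTensor V (j ∘ σ) = ((Equiv.Perm.sign σ : ℤ) : k) * blockTensor V j := by
  simp only [blockTensor, Finset.sum_apply, wedge_comp_perm, Finset.mul_sum]

/-- Every sum of wedge products comes from the blocks of a matrix. -/
theorem exists_blockTensor_eq {T : Tensor d ι k} {S : Fin s → Tensor d ι k}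
    (h : IsGrassmannDecomposition T S) :
    ∃ V : Matrix ι (BlockIdx d s) k, blockTensor V = T ∧
      IsGrassmannDecomposition T fun i => wedge (blockCols V i) := by
  choose hne v hv using h.1
  have hS : S = fun i => wedge (blockCols (Matrix.of fun x a => v a.2 a.1 x) i) := funext hv
  subst hS
  exact ⟨_, h.2, h⟩

/-- The fibers of a sum of wedge products are linear combinations of the vectors involved. -/
theorem exists_fibers_eq_mul [DecidableEq ι] {β : Type*} (V : Matrix ι (BlockIdx d s) k)
    (l : Fin d) (J : β → Fin d → ι) :
    ∃ C : Matrix (BlockIdx d s) β k, ∀ x b,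
      blockTensor V (Function.update (J b) l x) = (V * C) x b := by
  -- The cofactors along position `l` do not depend on the index at that position.
  refine ⟨Matrix.of fun a b =>
    (Matrix.of fun y z => blockCols V a.2 y (J b z)).adjugate l a.1, fun x b => ?_⟩
  simp only [blockTensor, Finset.sum_apply, wedge_update_index, Matrix.mul_apply,
    Fintype.sum_prod_type_right]
  rfl

/-- Reference fibers through the coordinates selected by `e`, one for each index `(l, i)`; on the
standard tensor they are signed unit vectors. -/
def pivotIdx (l : Fin d) (e : BlockIdx d r → ι) (b : BlockIdx d r) : Fin d → ι :=
  fun y => e (Equiv.swap l b.1 y, b.2)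

/-- A square submatrix of the flattening at position `l`. -/
def pivotMatrix [DecidableEq ι] (l : Fin d) (e : BlockIdx d r → ι) (T : Tensor d ι k) :
    Matrix (BlockIdx d r) (BlockIdx d r) k :=
  Matrix.of fun a b => T (Function.update (pivotIdx l e b) l (e a))

theorem pivotMatrix_factor [DecidableEq ι] (l : Fin d) (e : BlockIdx d r → ι)
    (V : Matrix ι (BlockIdx d s) k) :
    ∃ C : Matrix (BlockIdx d s) (BlockIdx d r) k,
      pivotMatrix l e (blockTensor V) = V.submatrix e id * C ∧
      ∀ x b, blockTensor V (Function.update (pivotIdx l e b) l x) = (V * C) x b := by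
  obtain ⟨C, hC⟩ := exists_fibers_eq_mul V l (pivotIdx l e)
  exact ⟨C, by ext a b; exact hC (e a) b, hC⟩

/-- The minor factors through the rows of `V` selected by `e`. This controls every decomposition of
length `r`, not just a chosen one. -/
theorem isUnit_of_pivotMatrix [DecidableEq ι] {l : Fin d} {e : BlockIdx d r → ι}
    {V : Matrix ι (BlockIdx d r) k} (h : (pivotMatrix l e (blockTensor V)).det ≠ 0) :
    IsUnit (V.submatrix e id).det := by
  obtain ⟨C, hC, -⟩ := pivotMatrix_factor l e V
  rw [hC, Matrix.det_mul] at h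
  exact (left_ne_zero_of_mul h).isUnit

/-- The column span of a flattening is spanned by the vectors of the decomposition. -/
theorem span_flattening [DecidableEq ι] (hd : 2 ≤ d) {l : Fin d} {e : BlockIdx d r → ι}
    {V : Matrix ι (BlockIdx d r) k} (h : (pivotMatrix l e (blockTensor V)).det ≠ 0) :
    Submodule.span k (Set.range (flattening l (blockTensor V)).col) =
      Submodule.span k (Set.range V.col) := by
  apply le_antisymm
  · rw [Submodule.span_le]
    rintro _ ⟨j, rfl⟩
    have : Nontrivial (Fin d) := Fin.nontrivial_iff_two_le.2 hd
    obtain ⟨y, hy⟩ := exists_ne l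
    obtain ⟨C, hC⟩ := exists_fibers_eq_mul V l
      -- A flattening index has no value at `l`; the filler used there is overwritten by the update.
      fun _ : Unit => fun z => if h : z = l then j ⟨y, hy⟩ else j ⟨z, h⟩
    refine span_col_mul_le V C (Submodule.subset_span ⟨(), ?_⟩)
    funext x
    rw [Matrix.col_apply, ← hC, Matrix.col_apply, flattening, Matrix.of_apply]
    congr 1
    funext z
    by_cases hz : z = l
    · subst hz; simp
    · simp [hz]
  · obtain ⟨C, hC, hF⟩ := pivotMatrix_factor l e V
    have hCu : IsUnit C.det := by
      rw [hC, Matrix.det_mul] at h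
      exact (right_ne_zero_of_mul h).isUnit
    have hV : V = (V * C) * C⁻¹ := by
      rw [Matrix.mul_assoc, Matrix.mul_nonsing_inv C hCu, Matrix.mul_one]
    have h1 : Submodule.span k (Set.range V.col) ≤
        Submodule.span k (Set.range (V * C).col) := by
      conv_lhs => rw [hV]
      exact span_col_mul_le _ _
    refine h1.trans (Submodule.span_le.2 ?_)
    rintro _ ⟨b, rfl⟩
    refine Submodule.subset_span ⟨fun z => pivotIdx l e b z, ?_⟩
    funext x
    rw [Matrix.col_apply, Matrix.col_apply, ← hF, flattening, Matrix.of_apply]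
    congr 1
    funext z
    by_cases hz : z = l
    · subst hz; simp
    · simp [hz]

theorem pivotMatrix_det_mem_polyFun [DecidableEq ι] (l : Fin d) (e : BlockIdx d r → ι) :
    (fun T : Tensor d ι k => (pivotMatrix l e T).det) ∈ polyFun k (Tensor d ι k) :=
  det_mem_polyFun fun a b =>
    dual_mem_polyFun (E := Tensor d ι k)
      (LinearMap.proj (R := k) (φ := fun _ : Fin d → ι => k)
        (Function.update (pivotIdx l e b) l (e a)))

/-- The coordinate matrix whose columns are the unit vectors selected by `e`. -/
def unitBlocks (k : Type*) [Field k] [DecidableEq ι] (e : BlockIdx d r → ι) :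
    Matrix ι (BlockIdx d r) k :=
  Matrix.of fun x a => if x = e a then 1 else 0

theorem unitBlocks_submatrix [DecidableEq ι] {e : BlockIdx d r → ι}
    (he : Function.Injective e) : (unitBlocks k e).submatrix e id = 1 := by
  ext a b
  simp [unitBlocks, Matrix.one_apply, he.eq_iff]

/-- Undoing the swap of positions costs a sign and reduces to `blockTensor_one_update`, so the pivot
matrix is diagonal with entries `±1`. -/
theorem pivotMatrix_unitBlocks [DecidableEq ι] (hd : 2 ≤ d) (l : Fin d) {e : BlockIdx d r → ι}
    (he : Function.Injective e) :
    (pivotMatrix l e (blockTensor (unitBlocks k e))).det ≠ 0 := by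
  have h : pivotMatrix l e (blockTensor (unitBlocks k e)) =
      Matrix.diagonal fun a => ((Equiv.Perm.sign (Equiv.swap l a.1) : ℤ) : k) := by
    ext a b
    have h1 : Function.update (pivotIdx l e b) l (e a) =
        e ∘ (Function.update (fun y => (y, b.2)) b.1 a ∘ Equiv.swap l b.1) := by
      funext y
      by_cases hy : y = l
      · subst hy; simp
      · have hy' : Equiv.swap l b.1 y ≠ b.1 := fun h' => hy (by
          rw [Equiv.swap_apply_eq_iff, Equiv.swap_apply_right] at h'; exact h')
        simp [hy, hy', pivotIdx]
    rw [pivotMatrix, Matrix.of_apply, h1, blockTensor_submatrix, unitBlocks_submatrix he,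
      blockTensor_comp_perm, blockTensor_one_update hd]
    by_cases hab : a = b
    · subst hab; simp
    · rw [Matrix.diagonal_apply_ne _ hab, if_neg hab, mul_zero]
  rw [h, Matrix.det_diagonal, Finset.prod_ne_zero_iff]
  intro a _
  rcases Int.units_eq_one_or (Equiv.Perm.sign (Equiv.swap l a.1)) with h | h <;> simp [h]

/-- The lower bound compares ranks: `s` wedge products make the invertible `dr × dr` pivot matrix
factor through `ds` columns. -/
theorem hasGrassmannRank_unitBlocks [DecidableEq ι] (hd : 2 ≤ d) {e : BlockIdx d r → ι}
    (he : Function.Injective e) : HasGrassmannRank (blockTensor (unitBlocks k e)) r := by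
  have hd0 : 0 < d := by omega
  constructor
  · refine ⟨fun i => wedge (blockCols (unitBlocks k e) i), fun i => ⟨fun h0 => ?_, _, rfl⟩, rfl⟩
    have h1 : wedge (blockCols (unitBlocks k e) i) (e ∘ fun l => (l, i)) = 1 := by
      rw [← wedge_blockCols_one_diag (d := d) (k := k) i, ← unitBlocks_submatrix (k := k) he]
      rfl
    exact zero_ne_one ((congrFun h0 _).symm.trans h1)
  · rintro s ⟨S, hS⟩
    obtain ⟨V, hV, -⟩ := exists_blockTensor_eq hS
    have hdet := pivotMatrix_unitBlocks (k := k) hd ⟨0, hd0⟩ he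
    obtain ⟨C, hC, -⟩ := pivotMatrix_factor ⟨0, hd0⟩ e V
    rw [← hV] at hdet
    have h1 := Matrix.rank_of_isUnit _ ((Matrix.isUnit_iff_isUnit_det _).2 hdet.isUnit)
    have h2 := Matrix.rank_mul_le_left (V.submatrix e id) C
    have h3 := Matrix.rank_le_card_width (V.submatrix e id)
    rw [← hC, h1] at h2
    have h4 := h2.trans h3
    simp only [Fintype.card_prod, Fintype.card_fin] at h4
    exact Nat.le_of_mul_le_mul_left h4 hd0

end Pivot

/-! ### Generic elements of the kernel, over the base field. -/

section GenericKernel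

variable {k L : Type*} [Field k] [Field L] [Algebra k L] {d r : ℕ}

theorem map_inv_algebraMap {ν : Type*} [Fintype ν] [DecidableEq ν] {M : Matrix ν ν k}
    (hM : IsUnit M.det) : (M.map (algebraMap k L))⁻¹ = M⁻¹.map (algebraMap k L) := by
  refine Matrix.inv_eq_left_inv ?_
  rw [← Matrix.map_mul, Matrix.nonsing_inv_mul M hM]
  exact Matrix.map_one _ (map_zero _) (map_one _)

theorem isUnit_det_map {ν : Type*} [Fintype ν] [DecidableEq ν] {M : Matrix ν ν k}
    (hM : IsUnit M.det) : IsUnit (M.map (algebraMap k L)).det := by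
  have h := RingHom.map_det (algebraMap k L) M
  rw [RingHom.mapMatrix_apply] at h
  rw [← h]
  exact hM.map _

theorem kappa_map_offDiag (hd : 3 ≤ d) {M X : Matrix (BlockIdx d r) (BlockIdx d r) k}
    (hM : IsUnit M.det) (hX : X ∈ kappa (blockTensor M)) (a b : BlockIdx d r) (hab : a.2 ≠ b.2) :
    ((M.map (algebraMap k L))⁻¹ * X.map (algebraMap k L) * M.map (algebraMap k L)) a b = 0 := by
  rw [map_inv_algebraMap hM, ← Matrix.map_mul, ← Matrix.map_mul, Matrix.map_apply,
    kappa_blockTensor_offDiag hd hM hX hab, map_zero]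

theorem exists_mem_kappa_traceHankel_ne_zero [CharZero k] (hd : 2 ≤ d)
    {M : Matrix (BlockIdx d r) (BlockIdx d r) k} (hM : IsUnit M.det) :
    ∃ K ∈ kappa (blockTensor M), (traceHankel K).det ≠ 0 := by
  obtain ⟨D, hD, htr⟩ := exists_injective_traceless k d r hd
  refine ⟨_, mem_kappa_blockTensor hM (Y := Matrix.diagonal D) (fun a b hab => ?_) ?_,
    (det_traceHankel_ne_zero_iff hM D).2 hD⟩
  · exact Matrix.diagonal_apply_ne _ fun h => hab (by rw [h])
  · simpa using htr

theorem traceHankel_map_ne_zero {ν : Type*} [Fintype ν] [DecidableEq ν] {K : Matrix ν ν k}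
    (h : (traceHankel K).det ≠ 0) : (traceHankel (K.map (algebraMap k L))).det ≠ 0 := by
  have h1 := RingHom.map_det (algebraMap k L) (traceHankel K)
  rw [RingHom.mapMatrix_apply] at h1
  rw [traceHankel_map, ← h1]
  exact (map_ne_zero _).2 h

/-- After a diagonalization with distinct eigenvalues of an element of the kernel, the eigenvectors
carry labels, and a generic element of the kernel has nonzero entries exactly inside the classes of
eigenvectors with the same label (apart from the diagonal entries). -/
theorem exists_labels_kappa [CharZero k] [CharZero L] (hd : 3 ≤ d)
    {M K : Matrix (BlockIdx d r) (BlockIdx d r) k} (hM : IsUnit M.det)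
    (hK : K ∈ kappa (blockTensor M)) {W : Matrix (BlockIdx d r) (BlockIdx d r) L}
    (hW : IsUnit W.det) {D : BlockIdx d r → L} (hD : Function.Injective D)
    (hKW : K.map (algebraMap k L) = W * Matrix.diagonal D * W⁻¹) :
    ∃ c : BlockIdx d r → Fin r, (∀ i, (Finset.univ.filter fun a => c a = i).card = d) ∧
      (∀ a, (blockIndicator L (c a) * ((M.map (algebraMap k L))⁻¹ * W)).col a =
        ((M.map (algebraMap k L))⁻¹ * W).col a) ∧
      ∃ f ∈ polyFun k (Matrix (BlockIdx d r) (BlockIdx d r) k),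
        (∃ X ∈ kappa (blockTensor M), f X ≠ 0) ∧
        ∀ X ∈ kappa (blockTensor M), f X ≠ 0 →
          (∀ a b, c a ≠ c b → (W⁻¹ * X.map (algebraMap k L) * W) a b = 0) ∧
          ∀ a b, a ≠ b → c a = c b → (W⁻¹ * X.map (algebraMap k L) * W) a b ≠ 0 := by
  classical
  set M' := M.map (algebraMap k L) with hM'
  have hMu : IsUnit M'.det := isUnit_det_map hM
  set N := M'⁻¹ * W with hN
  have hNu : IsUnit N.det := by
    rw [hN, Matrix.det_mul]
    exact (Matrix.isUnit_nonsing_inv_det M' hMu).mul hW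
  have hNinv : N⁻¹ = W⁻¹ * M' := by
    rw [hN, Matrix.mul_inv_rev, Matrix.nonsing_inv_nonsing_inv M' hMu]
  have hconj : ∀ X : Matrix (BlockIdx d r) (BlockIdx d r) L,
      W⁻¹ * X * W = N⁻¹ * (M'⁻¹ * X * M') * N := by
    intro X
    rw [hNinv, hN]
    simp only [Matrix.mul_assoc]
    rw [← Matrix.mul_assoc M' M'⁻¹ W, Matrix.mul_nonsing_inv M' hMu, Matrix.one_mul,
      ← Matrix.mul_assoc M' M'⁻¹, Matrix.mul_nonsing_inv M' hMu, Matrix.one_mul]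
  obtain ⟨c, hc, hcard⟩ := exists_labels hNu hD (by
    intro a b hab
    have h1 : N * Matrix.diagonal D * N⁻¹ = M'⁻¹ * K.map (algebraMap k L) * M' := by
      rw [hKW, hNinv, hN]
      simp only [Matrix.mul_assoc]
    rw [h1]
    exact kappa_map_offDiag hd hM hK a b hab)
  refine ⟨c, hcard, fun a => ?_, ?_⟩
  · have h1 : blockIndicator L (c a) * N =
        N * Matrix.diagonal fun b => if c b = c a then 1 else 0 := by
      rw [← hc, Matrix.mul_assoc N⁻¹, Matrix.mul_nonsing_inv_cancel_left _ _ hNu]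
    rw [h1]
    funext x
    rw [Matrix.col_apply, Matrix.mul_diagonal, if_pos rfl, mul_one, Matrix.col_apply]
  let P := {p : BlockIdx d r × BlockIdx d r // p.1 ≠ p.2 ∧ c p.1 = c p.2}
  have hg : ∀ p : P, ∃ g : Module.Dual k (Matrix (BlockIdx d r) (BlockIdx d r) k),
      (∃ X ∈ kappa (blockTensor M), g X ≠ 0) ∧
      ∀ X, g X ≠ 0 → (W⁻¹ * X.map (algebraMap k L) * W) p.1.1 p.1.2 ≠ 0 := by
    rintro ⟨⟨a, b⟩, hab, hlab⟩
    obtain ⟨Y, hY, htr, hne⟩ := exists_conj_ne_zero hNu hc hab hlab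
    let f : Matrix (BlockIdx d r) (BlockIdx d r) L →ₗ[L] L :=
      { toFun := fun Y => (N⁻¹ * Y * N) a b
        map_add' := fun Y Z => by simp [Matrix.mul_add, Matrix.add_mul]
        map_smul' := fun t Y => by simp }
    obtain ⟨Z, hZ, hZtr, hfZ⟩ := exists_descent (k := k) f hY htr hne
    let F : Matrix (BlockIdx d r) (BlockIdx d r) k →ₗ[k] L :=
      { toFun := fun X => (W⁻¹ * X.map (algebraMap k L) * W) a b
        map_add' := fun X Z => by
          rw [Matrix.map_add _ (map_add _), Matrix.mul_add, Matrix.add_mul, Matrix.add_apply]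
        map_smul' := fun t X => by
          rw [Matrix.map_smul' _ _ _ (map_mul _), Matrix.mul_smul, Matrix.smul_mul,
            Matrix.smul_apply, smul_eq_mul, RingHom.id_apply, Algebra.smul_def] }
    have hFZ : F (M * Z * M⁻¹) = f (Z.map (algebraMap k L)) := by
      change (W⁻¹ * (M * Z * M⁻¹).map (algebraMap k L) * W) a b =
        (N⁻¹ * Z.map (algebraMap k L) * N) a b
      rw [hconj, Matrix.map_mul, Matrix.map_mul, ← map_inv_algebraMap hM, ← hM']
      simp only [Matrix.mul_assoc, Matrix.nonsing_inv_mul M' hMu, Matrix.mul_one]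
      rw [← Matrix.mul_assoc M'⁻¹ M', Matrix.nonsing_inv_mul M' hMu, Matrix.one_mul]
    -- The entry takes values in `L`; composing with a `k`-linear form on `L` gives a linear form
    -- over `k` that still detects it.
    obtain ⟨ψ, hψ⟩ := Module.Projective.exists_dual_ne_zero k (hFZ ▸ hfZ)
    exact ⟨ψ ∘ₗ F, ⟨_, mem_kappa_blockTensor hM hZ hZtr, hψ⟩,
      fun X hX h0 => hX (by rw [LinearMap.comp_apply]; exact (congrArg ψ h0).trans (map_zero ψ))⟩
  choose g hgex hg using hg
  refine ⟨fun X => ∏ p, g p X, prod_mem_polyFun fun p _ => dual_mem_polyFun (g p), ?_, ?_⟩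
  · have : Infinite k := CharZero.infinite k
    -- Over an infinite field finitely many proper subspaces do not cover the kernel, so one `X`
    -- serves all pairs.
    obtain ⟨X, hX, hne⟩ := Module.Dual.exists_forall_mem_ne_zero_of_forall_exists _ g hgex
    exact ⟨X, hX, Finset.prod_ne_zero_iff.2 fun p _ => hne p⟩
  · intro X hX hne
    refine ⟨fun a b hab => ?_, fun a b hab hlab => ?_⟩
    · rw [hconj]
      exact conj_eq_zero_of_label_ne hNu hc (kappa_map_offDiag hd hM hX) hab
    · exact hg ⟨(a, b), hab, hlab⟩ X (Finset.prod_ne_zero_iff.1 hne _ (Finset.mem_univ _))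

end GenericKernel

/-! ### Orthonormal compression. -/

section Compression

variable {𝕜 : Type*} [RCLike 𝕜] {d r m : ℕ}

/-- The column span of a matrix with independent columns has an orthonormal basis. -/
theorem exists_orthonormal_cols {ν : Type*} [Fintype ν] [DecidableEq ν]
    {V : Matrix (Fin m) ν 𝕜} (hV : LinearIndependent 𝕜 V.col) :
    ∃ U : Matrix (Fin m) ν 𝕜, Uᴴ * U = 1 ∧
      Submodule.span 𝕜 (Set.range U.col) = Submodule.span 𝕜 (Set.range V.col) := by
  let e := (WithLp.linearEquiv 2 𝕜 (Fin m → 𝕜)).symm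
  let S : Submodule 𝕜 (EuclideanSpace 𝕜 (Fin m)) :=
    (Submodule.span 𝕜 (Set.range V.col)).map e.toLinearMap
  have hrank : Module.finrank 𝕜 S = Fintype.card ν := by
    rw [LinearEquiv.finrank_map_eq, finrank_span_eq_card hV]
  let b := (stdOrthonormalBasis 𝕜 S).reindex
    ((finCongr hrank).trans (Fintype.equivFin ν).symm)
  have hb := b.orthonormal
  refine ⟨Matrix.of fun x a => (b a : EuclideanSpace 𝕜 (Fin m)) x, ?_, ?_⟩
  · ext a c
    have h := orthonormal_iff_ite.1 hb a c
    rw [Submodule.coe_inner, PiLp.inner_apply] at h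
    rw [Matrix.mul_apply, Matrix.one_apply, ← h]
    simp [mul_comm]
  · have h1 : S = (Submodule.span 𝕜 (Set.range fun a => e.symm (b a))).map e.toLinearMap := by
      have h2 := congrArg (Submodule.map S.subtype) b.toBasis.span_eq
      rw [Submodule.map_span, Submodule.map_top, Submodule.range_subtype] at h2
      refine h2.symm.trans ?_
      rw [Submodule.map_span, ← Set.range_comp, ← Set.range_comp]
      rfl
    have h3 := Submodule.map_injective_of_injective (f := e.toLinearMap) e.injective h1
    exact h3.symm

/-- `U * Uᴴ` is the orthogonal projection onto the column span of `U`, which contains the columns of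
`V`. -/
theorem mul_conjTranspose_mul_of_span {ν : Type*} [Fintype ν] [DecidableEq ν]
    {U V : Matrix (Fin m) ν 𝕜} (hU : Uᴴ * U = 1)
    (h : Submodule.span 𝕜 (Set.range U.col) = Submodule.span 𝕜 (Set.range V.col)) :
    U * (Uᴴ * V) = V := by
  have h1 : ∀ c, U *ᵥ (Uᴴ *ᵥ V.col c) = V.col c := by
    intro c
    have h2 : V.col c ∈ LinearMap.range U.mulVecLin := by
      rw [Matrix.range_mulVecLin, h]
      exact Submodule.subset_span ⟨c, rfl⟩
    obtain ⟨y, hy⟩ := h2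
    rw [← hy, Matrix.mulVecLin_apply, Matrix.mulVec_mulVec _ Uᴴ, hU, Matrix.one_mulVec]
  ext x c
  exact congrFun (h1 c) x

end Compression

/-! ### Correctness of the algorithm. -/

section Correctness

variable {𝕜 : Type*} [RCLike 𝕜] {d r m : ℕ}

/-- The inclusion of the base field into the complex numbers as a ring homomorphism. -/
def toComplexHom (𝕜 : Type*) [RCLike 𝕜] : 𝕜 →+* ℂ where
  toFun := RCLike.map 𝕜 ℂ
  map_one' := by simp
  map_mul' x y := by
    apply Complex.ext <;> simp
  map_zero' := by simp
  map_add' := map_add _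

theorem tensorToComplex_wedge {ι : Type*} (v : Fin d → ι → 𝕜) :
    tensorToComplex (wedge v) = wedge fun l x => RCLike.map 𝕜 ℂ (v l x) := by
  funext j
  rw [tensorToComplex, wedge_apply, wedge_apply]
  exact RingHom.map_det (toComplexHom 𝕜) _

theorem tensorToComplex_blockTensor {ι : Type*} (V : Matrix ι (BlockIdx d r) 𝕜) :
    tensorToComplex (blockTensor V) = blockTensor (matrixToComplex V) := by
  funext j
  simp only [blockTensor, Finset.sum_apply]
  rw [tensorToComplex, Finset.sum_apply, map_sum]
  refine Finset.sum_congr rfl fun i _ => ?_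
  exact congrFun (tensorToComplex_wedge (blockCols V i)) j

theorem matrixToComplex_mul {α β γ : Type*} [Fintype β] (A : Matrix α β 𝕜) (B : Matrix β γ 𝕜) :
    matrixToComplex (A * B) = matrixToComplex A * matrixToComplex B :=
  Matrix.map_mul (f := toComplexHom 𝕜)

theorem wedge_blockCols_outputMatrix (hd : 0 < d) (U : Matrix (Fin m) (BlockIdx d r) 𝕜)
    (V : Matrix (BlockIdx d r) (BlockIdx d r) ℂ) (x : Fin r → ℂ) (i : Fin r) :
    wedge (blockCols (outputMatrix U V x) i) =
      x i • wedge (blockCols (matrixToComplex U * V) i) := by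
  rw [← wedge_update_smul _ ⟨0, hd⟩]
  congr 1
  funext l a
  by_cases hl : l = ⟨0, hd⟩
  · subst hl; simp [blockCols, outputMatrix]
  · have hl' : l.val ≠ 0 := fun h => hl (Fin.ext h)
    rw [Function.update_of_ne hl]
    simp [blockCols, outputMatrix, hl']

/-- The last two steps of the algorithm are correct as soon as the blocks represent the summands
up to nonzero factors and a permutation. -/
theorem scalars_and_output (hd : 0 < d) {T : Tensor d (Fin m) 𝕜}
    {V : Matrix (Fin m) (BlockIdx d r) 𝕜}
    (hV : IsGrassmannDecomposition T fun i => wedge (blockCols V i))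
    {U : Matrix (Fin m) (BlockIdx d r) 𝕜} {M : Matrix (BlockIdx d r) (BlockIdx d r) 𝕜}
    (hUM : U * M = V) (hM : IsUnit (matrixToComplex M).det)
    {V' : Matrix (BlockIdx d r) (BlockIdx d r) ℂ} (τ : Equiv.Perm (Fin r)) (g : Fin r → ℂ)
    (hg : ∀ i, g i ≠ 0)
    (hV' : ∀ i, wedge (blockCols V' i) = g i • wedge (blockCols (matrixToComplex M) (τ i))) :
    (∃! x : Fin r → ℂ, SolvesScalars V' (tensorToComplex (blockTensor M)) x) ∧
      ∀ x : Fin r → ℂ, SolvesScalars V' (tensorToComplex (blockTensor M)) x →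
        RepresentsDecomposition T (outputMatrix U V' x) := by
  -- The right-hand side has all coefficients one in the independent wedge products of the blocks of
  -- `M`; comparing coefficients determines `x`.
  have key : ∀ x, SolvesScalars V' (tensorToComplex (blockTensor M)) x ↔
      ∀ i, x i * g i = 1 := by
    intro x
    have h1 : ∑ i, x i • wedge (blockCols V' i) =
        ∑ i, (x (τ.symm i) * g (τ.symm i)) • wedge (blockCols (matrixToComplex M) i) := by
      refine Eq.trans (Finset.sum_congr rfl fun i _ => ?_) (Equiv.sum_comp τ _)
      rw [hV', smul_smul, Equiv.symm_apply_apply]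
    have h2 : tensorToComplex (blockTensor M) =
        ∑ i, (1 : Fin r → ℂ) i • wedge (blockCols (matrixToComplex M) i) := by
      rw [tensorToComplex_blockTensor]
      simp [blockTensor]
    rw [SolvesScalars, h1, h2]
    constructor
    · intro h i
      have h3 := congrFun (sum_smul_wedge_injective hd hM h) (τ i)
      simpa using h3
    · intro h
      simp [h]
  refine ⟨⟨fun i => (g i)⁻¹, (key _).2 fun i => inv_mul_cancel₀ (hg i), fun y hy => ?_⟩,
    fun x hx => ?_⟩
  · funext i
    exact eq_inv_of_mul_eq_one_left ((key y).1 hy i)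
  -- The factors cancel, which leaves the original summands over `𝕜`, permuted by `τ`.
  · refine ⟨fun i => wedge (blockCols V (τ i)), ⟨fun i => hV.1 _, ?_⟩, fun i => ?_⟩
    · rw [← hV.2]
      exact Equiv.sum_comp τ fun i => wedge (blockCols V i)
    · rw [wedge_blockCols_outputMatrix hd, ← multilinearMul_blockCols, hV',
        multilinearMul_smul, smul_smul, (key x).1 hx i, one_smul, multilinearMul_blockCols,
        ← matrixToComplex_mul, hUM, tensorToComplex_wedge]
      rfl

theorem algorithmCorrectOn_of_pivot (hd : 3 ≤ d) (l : Fin d) {e : BlockIdx d r → Fin m}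
    {T : Tensor d (Fin m) 𝕜} (hT : HasGrassmannRank T r)
    (hpivot : (pivotMatrix l e T).det ≠ 0) : AlgorithmCorrectOn r l T := by
  classical
  have hd0 : 0 < d := by omega
  obtain ⟨S, hS⟩ := hT.1
  obtain ⟨V, rfl, hV⟩ := exists_blockTensor_eq hS
  have hR := isUnit_of_pivotMatrix hpivot
  have hspan := span_flattening (by omega) hpivot
  have hVli : LinearIndependent 𝕜 V.col := by
    have h1 : LinearIndependent 𝕜 (V.submatrix e id).col := by
      rw [Matrix.linearIndependent_cols_iff_isUnit, Matrix.isUnit_iff_isUnit_det]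
      exact hR
    exact LinearIndependent.of_comp (LinearMap.funLeft 𝕜 𝕜 e) h1
  constructor
  · obtain ⟨U, hU, hUV⟩ := exists_orthonormal_cols hVli
    exact ⟨U, hU, hUV.trans hspan.symm⟩
  intro U hU
  set M := Uᴴ * V with hMdef
  have hUM : U * M = V := mul_conjTranspose_mul_of_span hU.1 (hU.2.trans hspan)
  have hM : IsUnit M.det := by
    -- `M` is a right factor of the invertible matrix of pivot rows of `V`.
    have h1 : U.submatrix e id * M = V.submatrix e id := by
      rw [← hUM]
      rfl
    rw [← h1, Matrix.det_mul] at hR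
    exact isUnit_of_mul_isUnit_right hR
  have hcomp : compress U (blockTensor V) = blockTensor M := multilinearMul_blockTensor _ _
  rw [hcomp]
  let _ : Algebra 𝕜 ℂ := (toComplexHom 𝕜).toAlgebra
  have hMC : IsUnit (matrixToComplex M).det := isUnit_det_map (L := ℂ) hM
  refine Generic.of_polyFun det_traceHankel_mem_polyFun
    (exists_mem_kappa_traceHankel_ne_zero (by omega) hM) fun K hK hKdet => ?_
  have hKdet' : (traceHankel (matrixToComplex K)).det ≠ 0 := traceHankel_map_ne_zero hKdet
  refine ⟨exists_diagonalization hKdet', ?_⟩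
  rintro W D ⟨hW, hKW⟩
  have hD : Function.Injective D := by
    rw [hKW] at hKdet'
    exact (det_traceHankel_ne_zero_iff hW D).1 hKdet'
  obtain ⟨c, hcard, hlab, f, hf, hfex, hfne⟩ :=
    exists_labels_kappa (L := ℂ) hd hM hK hW hD hKW
  refine Generic.of_polyFun hf hfex fun K' hK' hne => ?_
  obtain ⟨hzero, hnonzero⟩ := hfne K' hK' hne
  constructor
  · obtain ⟨ρ, hρ⟩ := exists_perm_label hcard
    -- The inverse appears because conjugation by `permMatrix π` reindexes by `π.symm`.
    refine ⟨Equiv.Perm.permMatrix ℂ ρ.symm, ⟨ρ.symm, rfl⟩,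
      fun i => Matrix.of fun a b => (W⁻¹ * matrixToComplex K' * W) (ρ (a, i)) (ρ (b, i)), ?_⟩
    rw [permMatrix_conj]
    ext ⟨a, i⟩ ⟨b, j⟩
    rw [Matrix.blockDiagonal_apply]
    split_ifs with h
    · simp only at h
      subst h
      simp
    · exact hzero _ _ (by simpa [hρ] using h)
  · rintro _ ⟨⟨π, rfl⟩, B, hB⟩ V' hV'
    rw [permMatrix_conj] at hB
    obtain ⟨τ, hτ⟩ := exists_perm_of_blockDiagonal hd0 hcard hnonzero (ρ := π.symm) (by
      intro a b hab
      have h1 := congrFun (congrFun hB a) b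
      rw [Matrix.submatrix_apply, Matrix.blockDiagonal_apply, if_neg hab] at h1
      exact h1)
    have hex : ∀ i, ∃ g : ℂ, g ≠ 0 ∧
        wedge (blockCols V' i) = g • wedge (blockCols (matrixToComplex M) (τ i)) := by
      intro i
      refine exists_wedge_eq_of_span hMC hW (w := fun a => π.symm (a, i))
        (fun a b h => congrArg Prod.fst (π.symm.injective h)) (fun a => ?_) ?_
      · have h1 := hlab (π.symm (a, i))
        rw [hτ] at h1
        exact h1
      · rw [hV' i, mul_permMatrix_apply]
        rfl
    choose g hg hV'g using hex
    exact scalars_and_output hd0 hV hUM hMC τ g hg hV'g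

end Correctness

end GrassmannAlg
end

theorem theorem3p8 {𝕜 : Type*} [RCLike 𝕜] (d r m : ℕ) (hd : 3 ≤ d) (hm : d * r ≤ m) :
    GrassmannAlg.Generic 𝕜
      {T : GrassmannAlg.Tensor d (Fin m) 𝕜 | GrassmannAlg.HasGrassmannRank T r}
      (fun T => GrassmannAlg.AlgorithmCorrectOn r (⟨0, by omega⟩ : Fin d) T) := by
  -- Since `d * r ≤ m`, there are enough distinct coordinates to carry the pivot minor and the
  -- rank-`r` tensor at which it is nonzero.
  obtain ⟨e⟩ : Nonempty (GrassmannAlg.BlockIdx d r ↪ Fin m) :=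
    Function.Embedding.nonempty_of_card_le (by simpa using hm)
  exact GrassmannAlg.Generic.of_polyFun
    (GrassmannAlg.pivotMatrix_det_mem_polyFun ⟨0, by omega⟩ e)
    ⟨_, GrassmannAlg.hasGrassmannRank_unitBlocks (by omega) e.injective,
      GrassmannAlg.pivotMatrix_unitBlocks (by omega) _ e.injective⟩
    fun _ hT hne => GrassmannAlg.algorithmCorrectOn_of_pivot hd _ hT hne
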